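/- Conventions. Let $N\ge 1$, let $s_1,\dots,s_d$ be positive integers with $s_1+\dots+s_d=2N$, and put $q_0=0$, $q_i=s_1+\dots+s_i$. An $N$-link pattern is a non-crossing perfect matching of $\{1,\dots,2N\}$. It is identified with its Dyck path on $\{0,\dots,2N\}$, which goes up at left endpoints and down at right endpoints of links. We write $\beta\succeq\alpha$ if the path of $\beta$ lies weakly above that of $\alpha$, and then $\#\mathcal C(\alpha/\beta)$ denotes the number of cover-inclusive Dyck tilings of the skew Young diagram between the two paths: tilings by Dyck tiles (ribbons of boxes whose centres form a path that ends at its initial height and never goes below it) such that a tile having a box straight above a box of another tile has its horizontal extent included in that of the other tile. For a symmetric kernel $\mathfrak K$ on $\{1,\dots,2N\}$ with complex values and for $\beta=\{\{a_1,b_1\},\dots,\{a_N,b_N\}\}$ with $a_1<\dots<a_N$ and $a_k<b_k$, let $\Delta^{\mathfrak K}_\beta=\det(\mathfrak K(a_k,b_\ell))_{k,\ell=1}^N$, and let $$\mathfrak Z^{\mathfrak K}_\alpha=\sum_{\beta\succeq\alpha}\#\mathcal C(\alpha/\beta)\,\Delta^{\mathfrak K}_\beta$$ be the inverse Fomin type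 sum. (Diagonal entries of $\mathfrak K$ never occur.) Let $\mathfrak X_n=\{x\in\mathbb R^n: x_1<\dots<x_n\}$. Setup. Fix $j\in\{1,\dots,d\}$, put $J=\{q_{j-1}+1,\dots,q_j\}$, and let $\alpha$ be an $N$-link pattern that comes from a valenced link pattern with valences $(s_1,\dots,s_d)$, i.e. no link of $\alpha$ has both endpoints in the same block $\{q_{i-1}+1,\dots,q_i\}$, $1\le i\le d$. Let $\mathfrak K(a,b)=\mathfrak K(b,a)=K_{a,b}(x_a,x_b)$ for $a<b$, where $K_{a,b}$ is a smooth complex-valued function on $\{(u,v):u<v\}$, and regard $\mathfrak Z^{\mathfrak K}_\alpha$ as a function on $\mathfrak X_{2N}$. Assume that for every $b\notin J$ there are constants $C_b\ne0$ and $p_b\ge 0$, depending only on $b$, such that $\mathfrak K(a,b)=C_b\,|x_b-x_a|^{-p_b}$ for all $a\in J$. For $x\in\mathfrak X_{2N}$ let $\delta_k=x_{q_{j-1}+k}-x_{q_{j-1}+1}$ for $1\le k\le s_j$, let $\hat x=(x_1,\dots,x_{q_{j-1}+1},x_{q_j+1},\dots,x_{2N})\in\mathfrak X_{2N-s_j+1}$,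 and put $D(x)=\prod_{p=2}^{s_j}\delta_p\prod_{2\le q<r\le s_j}(\delta_r-\delta_q)$. Let $\mathfrak K'$ be the symmetric kernel, depending on $\hat x$, with $\mathfrak K'(a,b)=0$ for $a,b\in J$, with $$\mathfrak K'(q_{j-1}+m,b)=\frac1{(m-1)!}\,\frac{d^{m-1}}{dt^{m-1}}\Big(C_b|x_b-t|^{-p_b}\Big)\Big|_{t=x_{q_{j-1}+1}}\qquad (1\le m\le s_j,\ b\notin J),$$ and $\mathfrak K'(a,b)=\mathfrak K(a,b)$ for $a,b\notin J$. Claim. Let $K\subset\mathfrak X_{2N-s_j+1}$ be compact. (1) $\mathfrak Z^{\mathfrak K}_\alpha(x)=D(x)\,\big(\mathfrak Z^{\mathfrak K'}_\alpha(\hat x)+o(1)\big)$ as $\delta_{s_j}\downarrow0$, uniformly over $\hat x\in K$. (2) If $\mathfrak Z^{\mathfrak K'}_\alpha$ has no zero on $K$, then $\mathfrak Z^{\mathfrak K}_\alpha(x)=D(x)\,\mathfrak Z^{\mathfrak K'}_\alpha(\hat x)\,(1+o(1))$ as $\delta_{s_j}\downarrow0$, uniformly over $\hat x\in K$. -/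

import Mathlib

namespace FominSum

/-! ### Link patterns and their Dyck paths -/

/-- A planar link pattern of `N` links: a fixed-point-free involution of the `2N` indices
without crossings. The link of `a` is `{a, partner a}`. -/
@[ext]
structure LinkPattern (N : ℕ) where
  partner : Fin (2 * N) → Fin (2 * N)
  partner_partner : ∀ a, partner (partner a) = a
  partner_ne : ∀ a, partner a ≠ a
  noncrossing : ∀ a b, a < b → b < partner a → ¬ partner a < partner b

noncomputable instance (N : ℕ) : Fintype (LinkPattern N) :=
  Fintype.ofInjective LinkPattern.partner (fun _ _ h => LinkPattern.ext h)

/-- The Dyck path of a link pattern. Its value at `k` is the number of links `{i, partner i}`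
with `i` among the first `k` indices and `partner i` not among them, that is, the number of left
endpoints minus the number of right endpoints among the first `k` indices. -/
def LinkPattern.height {N : ℕ} (α : LinkPattern N) (k : ℕ) : ℕ :=
  (Finset.univ.filter fun i : Fin (2 * N) => i.val < k ∧ k ≤ (α.partner i).val).card

/-- `α ⪯ β`: the Dyck path of `α` stays weakly below that of `β`. -/
def LinkPattern.Below {N : ℕ} (α β : LinkPattern N) : Prop :=
  ∀ k, k ≤ 2 * N → α.height k ≤ β.height k

/-! ### Cover-inclusive Dyck tilings -/

/-- The unit boxes of the skew Young diagram `α/β` between the lower path `α` and the upper path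
`β`, in Russian orientation: the pair `(k, h)` is the centre of the box with corners
`(k ± 1, h)` and `(k, h ± 1)`. -/
def skewBoxes {N : ℕ} (α β : LinkPattern N) : Finset (ℕ × ℕ) :=
  (Finset.range (2 * N + 1) ×ˢ Finset.range (2 * N + 1)).filter fun c =>
    Odd (c.1 + c.2) ∧ α.height c.1 < c.2 ∧ c.2 < β.height c.1

/-- A Dyck tile: a ribbon of boxes whose centres, from left to right, form a (possibly one-point)
lattice path that ends at its initial height and never goes below it. -/
def IsDyckTile (t : Finset (ℕ × ℕ)) : Prop :=
  ∃ (x y : ℕ) (h : ℕ → ℕ), x ≤ y ∧ h y = h x ∧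
    (∀ k, x ≤ k → k ≤ y → h x ≤ h k) ∧
    (∀ k, x ≤ k → k < y → h (k + 1) = h k + 1 ∨ h k = h (k + 1) + 1) ∧
    t = (Finset.Icc x y).image fun k => (k, h k)

/-- The columns met by a tile (its horizontal extent). -/
def columns (t : Finset (ℕ × ℕ)) : Finset ℕ := t.image Prod.fst

/-- `t` covers `u`: some box of `t` is straight above some box of `u`. -/
def Covers (t u : Finset (ℕ × ℕ)) : Prop :=
  ∃ c ∈ t, ∃ e ∈ u, c.1 = e.1 ∧ e.2 < c.2

/-- A cover-inclusive Dyck tiling of the skew Young diagram `α/β`: a partition of its boxes into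
Dyck tiles such that the horizontal extent of a tile is included in the horizontal extent of each
tile that it covers. -/
def IsCoverInclusiveTiling {N : ℕ} (α β : LinkPattern N)
    (T : Finset (Finset (ℕ × ℕ))) : Prop :=
  (∀ t ∈ T, IsDyckTile t) ∧
  (∀ t ∈ T, ∀ u ∈ T, t ≠ u → Disjoint t u) ∧
  T.biUnion id = skewBoxes α β ∧
  (∀ t ∈ T, ∀ u ∈ T, t ≠ u → Covers t u → columns t ⊆ columns u)

open Classical in
/-- The number `#C(α/β)` of cover-inclusive Dyck tilings of `α/β`. -/
noncomputable def tilingCount {N : ℕ} (α β : LinkPattern N) : ℕ :=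
  ((skewBoxes α β).powerset.powerset.filter fun T => IsCoverInclusiveTiling α β T).card

/-! ### Inverse Fomin type sums -/

/-- The determinant of a link pattern with kernel `𝔎`, namely `det (𝔎 (a_k, b_l))` where the
`a_k` are the left endpoints of the links and `b_k` is the right endpoint of the link of `a_k`.
Rows and columns are both indexed by the left endpoints. -/
def fominDet {N : ℕ} (𝔎 : Fin (2 * N) → Fin (2 * N) → ℂ) (β : LinkPattern N) : ℂ :=
  (Matrix.of fun a b : {i : Fin (2 * N) // i < β.partner i} =>
    𝔎 a.val (β.partner b.val)).det

open Classical in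
/-- The inverse Fomin type sum of `α` with kernel `𝔎`. -/
noncomputable def inverseFominSum {N : ℕ} (𝔎 : Fin (2 * N) → Fin (2 * N) → ℂ)
    (α : LinkPattern N) : ℂ :=
  ∑ β ∈ Finset.univ.filter (fun β : LinkPattern N => α.Below β),
    (tilingCount α β : ℂ) * fominDet 𝔎 β

/-! ### Valences -/

/-- Valences `(s_1, …, s_d)`: positive integers of total `n`. They cut the indices into `d`
consecutive blocks, the `j`-th of length `s_j`. -/
structure Valences (d n : ℕ) where
  s : Fin d → ℕ
  pos : ∀ j, 0 < s j
  sum_eq : ∑ j, s j = n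

namespace Valences

variable {d n : ℕ} (ς : Valences d n) (j : Fin d)

/-- The number of indices before the `j`-th block. -/
def start : ℕ := ∑ i ∈ Finset.Iio j, ς.s i

theorem start_add_le : ς.start j + ς.s j ≤ n := by
  have h : ς.start j + ς.s j = ∑ i ∈ Finset.Iic j, ς.s i := by
    rw [start, ← Finset.Iio_insert, Finset.sum_insert (by simp)]
    exact Nat.add_comm _ _
  calc ς.start j + ς.s j = ∑ i ∈ Finset.Iic j, ς.s i := h
    _ ≤ ∑ i, ς.s i := Finset.sum_le_sum_of_subset (Finset.subset_univ _)
    _ = n := ς.sum_eq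

/-- The `j`-th block of indices. -/
def block : Finset (Fin n) :=
  Finset.univ.filter fun k => ς.start j ≤ k.val ∧ k.val < ς.start j + ς.s j

/-- The `m`-th index of the `j`-th block, `m = 0, …, s_j - 1`. -/
def point (m : Fin (ς.s j)) : Fin n :=
  ⟨ς.start j + m.val, by have := ς.start_add_le j; omega⟩

/-- The first index of the `j`-th block. -/
def first : Fin n := ς.point j ⟨0, ς.pos j⟩

/-- Indices before fusion to indices after fusion of the `j`-th block: the whole block goes to one
index, the order is kept. -/
def fuse (k : Fin n) : Fin (n - ς.s j + 1) :=
  ⟨if k.val < ς.start j then k.val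
    else if k.val < ς.start j + ς.s j then ς.start j
    else k.val - ς.s j + 1, by
      have := ς.start_add_le j
      have := ς.pos j
      have := k.isLt
      split_ifs <;> omega⟩

/-- The inverse map on indices, where the fused index goes to the first index of the block. -/
def keep (i : Fin (n - ς.s j + 1)) : Fin n :=
  ⟨if i.val ≤ ς.start j then i.val else i.val + ς.s j - 1, by
      have := ς.start_add_le j
      have := ς.pos j
      have := i.isLt
      split_ifs <;> omega⟩

/-- The configuration `x̂`, obtained from `x` by leaving out all points of the `j`-th block but the
first one. -/
def reduce (x : Fin n → ℝ) : Fin (n - ς.s j + 1) → ℝ := fun i => x (ς.keep j i)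

/-- The distance from the first point of the `j`-th block to its `m`-th point
(counted from `m = 0`). -/
def gap (x : Fin n → ℝ) (m : Fin (ς.s j)) : ℝ := x (ς.point j m) - x (ς.first j)

/-- The normalizing factor `∏ δ_p ∏ (δ_r - δ_q)` over the points of the block other than the
first one, where `q < r`. -/
noncomputable def fusionFactor (x : Fin n → ℝ) : ℝ :=
  (∏ p : Fin (ς.s j) with 0 < p.val, ς.gap j x p) *
    ∏ qr : Fin (ς.s j) × Fin (ς.s j) with 0 < qr.1.val ∧ qr.1 < qr.2,
      (ς.gap j x qr.2 - ς.gap j x qr.1)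

end Valences

/-- A valenced link pattern, identified with the link pattern that opens up its valenced nodes:
no link joins two indices of one block. -/
def LinkPattern.IsValenced {N d : ℕ} (α : LinkPattern N) (ς : Valences d (2 * N)) : Prop :=
  ∀ i : Fin d, ∀ a ∈ ς.block i, α.partner a ∉ ς.block i

/-! ### Kernels as functions of the points -/

/-- The chamber of configurations `x_1 < ⋯ < x_n` in `ℝⁿ`. -/
def chamber (n : ℕ) : Set (Fin n → ℝ) := {x | StrictMono x}

/-- The symmetric kernel with entries `F a b (x_a) (x_b)` for `a < b`. Diagonal entries never
enter an inverse Fomin type sum, they are set to `0`. -/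
def kernel {n : ℕ} (F : Fin n → Fin n → ℝ → ℝ → ℂ) (x : Fin n → ℝ) (a b : Fin n) : ℂ :=
  if a < b then F a b (x a) (x b) else if b < a then F b a (x b) (x a) else 0

/-- The fused kernel on configurations `y` after fusion of the `j`-th block, at the fused point
`ξ`: the entries inside the block are `0`, the entry between the `m`-th index of the block
(counted from `m = 0`) and an index `b` outside is `f_b^{(m)}(ξ) / m!`, where `f_b = f b (x_b)`,
and all other entries are those of the original kernel. -/
noncomputable def fusedKernel {d n : ℕ} (ς : Valences d n) (j : Fin d)
    (F : Fin n → Fin n → ℝ → ℝ → ℂ) (f : Fin n → ℝ → ℝ → ℂ)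
    (y : Fin (n - ς.s j + 1) → ℝ) (a b : Fin n) : ℂ :=
  let ξ : ℝ := y (ς.fuse j (ς.first j))
  let entry (m : ℕ) (c : Fin n) : ℂ :=
    (1 / (m.factorial : ℂ)) * iteratedDeriv m (f c (y (ς.fuse j c))) ξ
  if a ∈ ς.block j then
    if b ∈ ς.block j then 0 else entry (a.val - ς.start j) b
  else
    if b ∈ ς.block j then entry (b.val - ς.start j) a
    else kernel F (fun k => y (ς.fuse j k)) a b

/-- The function `t ↦ C_b |x_b - t|^{-p_b}`, where `u` is the value of `x_b`. -/
noncomputable def powerEntry {n : ℕ} (C : Fin n → ℂ) (p : Fin n → ℝ)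
    (b : Fin n) (u t : ℝ) : ℂ :=
  C b * ((|u - t| ^ (-p b) : ℝ) : ℂ)

end FominSum

open FominSum

namespace FominSum

/-! ### Dyck paths of link patterns and local moves on them -/

namespace LinkPattern

variable {N : ℕ} (α β : LinkPattern N)

/-! The heart of the matter is antisymmetry. If `α` does not link the neighbours `a`, `b = a + 1`,
then exchanging `a` and `b` in the kernel changes the sign of the sum (`inverseFominSum_swap`). If
the path of `β` has a slope at `a`, `b`, the exchange swaps two rows or two columns of the
determinant of `β`. Valleys and peaks are paired by `LinkPattern.up`, and the exchange turns the
determinant of one partner into minus that of the other. The weights of the partners agree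
(`tilingCount_up`): since `α` has no peak there, the additional box is a tile of its own in every
cover-inclusive tiling.

Transpositions inside a block are products of such exchanges, because `α` has no link inside the
block. A determinant depends on the entry at `{a, b}` through a cofactor that involves neither
index, whereas the sum changes its sign when `a` and `b` are exchanged; so the sum does not see the
entries inside the block (`inverseFominSum_erase_block`). With these set to `0`, it is an
alternating multilinear function of the rows of the block (`blockAlternating`).

Newton interpolation at the points of the block writes these rows as a triangular matrix times rows
of normalized derivatives at intermediate points `θ m b` (`exists_newton_mean_value`). The matrix is
the same for all `b`, and its determinant is `D(x)`. Hence the sum is exactly `D(x)` times the fused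
sum with perturbed evaluation points (`exists_inverseFominSum_eq`). As the block shrinks, these
points tend to the fused point, and continuity together with compactness gives (1). For (2), the
fused sum is bounded away from zero on the compact set. -/

theorem partner_eq_iff {a b : Fin (2 * N)} : α.partner a = b ↔ a = α.partner b :=
  ⟨fun h => by rw [← h, α.partner_partner], fun h => by rw [h, α.partner_partner]⟩

theorem partner_injective : Function.Injective α.partner :=
  Function.LeftInverse.injective α.partner_partner

theorem height_zero : α.height 0 = 0 := by
  simp [height]

theorem height_le (k : ℕ) : α.height k ≤ 2 * N :=
  (Finset.card_le_univ _).trans (by simp)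

/-- The path goes up at left endpoints. -/
theorem height_succ_of_lt {a : Fin (2 * N)} (h : a < α.partner a) :
    α.height (a.val + 1) = α.height a.val + 1 := by
  rw [height, height, ← Finset.card_insert_of_notMem (a := a) (by simp)]
  congr 1
  ext i
  have h1 : (α.partner i).val = a.val → i = α.partner a := fun e =>
    (α.partner_eq_iff).1 (Fin.ext e)
  simp only [Finset.mem_filter, Finset.mem_univ, true_and, Finset.mem_insert]
  constructor
  · rintro ⟨h2, h3⟩
    by_cases hi : i = a
    · exact Or.inl hi
    · right
      have : i.val ≠ a.val := fun e => hi (Fin.ext e)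
      omega
  · rintro (rfl | ⟨h2, h3⟩)
    · exact ⟨by omega, by have := Fin.lt_def.1 h; omega⟩
    · refine ⟨by omega, ?_⟩
      by_contra h4
      have := h1 (by omega)
      subst this
      have := Fin.lt_def.1 h
      omega

/-- The path goes down at right endpoints. -/
theorem height_succ_of_gt {a : Fin (2 * N)} (h : α.partner a < a) :
    α.height a.val = α.height (a.val + 1) + 1 := by
  have ha := Fin.lt_def.1 h
  rw [height, height, ← Finset.card_insert_of_notMem (a := α.partner a)
    (by simp [α.partner_partner])]
  congr 1
  ext i
  have h1 : (α.partner i).val = a.val → i = α.partner a := fun e =>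
    (α.partner_eq_iff).1 (Fin.ext e)
  simp only [Finset.mem_filter, Finset.mem_univ, true_and, Finset.mem_insert]
  constructor
  · rintro ⟨h2, h3⟩
    by_cases hi : (α.partner i).val = a.val
    · exact Or.inl (h1 hi)
    · right
      omega
  · rintro (rfl | ⟨h2, h3⟩)
    · rw [α.partner_partner]; exact ⟨ha, le_rfl⟩
    · refine ⟨?_, by omega⟩
      by_contra h4
      have : i = a := Fin.ext (by omega)
      subst this
      omega

theorem lt_or_gt (a : Fin (2 * N)) : a < α.partner a ∨ α.partner a < a :=
  lt_or_gt_of_ne (α.partner_ne a).symm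

theorem even_height_add {k : ℕ} (hk : k ≤ 2 * N) : Even (α.height k + k) := by
  induction k with
  | zero => simp [height_zero]
  | succ k ih =>
    have ih := ih (by omega)
    rw [Nat.even_iff] at *
    rcases α.lt_or_gt ⟨k, hk⟩ with h | h
    · have := α.height_succ_of_lt h
      simp only at this
      omega
    · have := α.height_succ_of_gt h
      simp only at this
      omega

/-- Two neighbouring indices that form a peak of the path are linked. -/
theorem partner_eq_of_peak {a b : Fin (2 * N)} (hab : b.val = a.val + 1)
    (ha : a < α.partner a) (hb : α.partner b < b) : α.partner a = b := by
  by_contra hne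
  have hne' : α.partner b ≠ a := fun h => hne ((α.partner_eq_iff).1 h).symm
  rw [Fin.lt_def] at ha hb
  have h1 : (α.partner a).val ≠ b.val := fun e => hne (Fin.ext e)
  have h2 : (α.partner b).val ≠ a.val := fun e => hne' (Fin.ext e)
  refine α.noncrossing (α.partner b) a ?_ ?_ ?_ <;>
    simp only [α.partner_partner, Fin.lt_def] <;> omega

/-! ### Rewiring two links -/

/-- Replaces the links `{u, p u}` and `{v, p v}` by `{u, v}` and `{p u, p v}`. -/
def rewire (p : Fin (2 * N) → Fin (2 * N)) (u v x : Fin (2 * N)) : Fin (2 * N) :=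
  if x = u then v else if x = v then u else if x = p u then p v else if x = p v then p u else p x

theorem rewire_rewire_apply {u v : Fin (2 * N)} (h1 : v ≠ α.partner u)
    (x : Fin (2 * N)) : rewire α.partner u v (rewire α.partner u v x) = x := by
  have hp := α.partner_partner
  have hn := α.partner_ne
  have hi := α.partner_injective
  simp only [rewire]
  grind

theorem rewire_ne {u v : Fin (2 * N)} (h0 : u ≠ v) (x : Fin (2 * N)) :
    rewire α.partner u v x ≠ x := by
  have hp := α.partner_partner
  have hn := α.partner_ne
  have hi := α.partner_injective
  simp only [rewire]
  grind

/-- The indices inside a link are linked to each other. -/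
theorem partner_mem_Ioo {u x : Fin (2 * N)} (h1 : u < x) (h2 : x < α.partner u) :
    u < α.partner x ∧ α.partner x < α.partner u := by
  have h3 := α.noncrossing u x h1 h2
  have hx : α.partner x ≠ α.partner u := fun h => h1.ne (α.partner_injective h).symm
  have hx' : α.partner x ≠ u := fun h => h2.ne ((α.partner_eq_iff).1 h)
  refine ⟨?_, lt_of_le_of_ne (not_lt.1 h3) hx⟩
  by_contra h4
  exact α.noncrossing (α.partner x) u (lt_of_le_of_ne (not_lt.1 h4) hx')
    (by rwa [α.partner_partner]) (by rwa [α.partner_partner])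

/-- Turns the valley at the neighbouring indices `a`, `b` into a peak. -/
def up (a b : Fin (2 * N)) (hab : b.val = a.val + 1) (ha : β.partner a < a)
    (hb : b < β.partner b) : LinkPattern N where
  partner := rewire β.partner a b
  partner_partner := β.rewire_rewire_apply (by omega)
  partner_ne := β.rewire_ne (by intro h; subst h; omega)
  noncrossing := by
    intro x y hxy hyx hcr
    have hp := β.partner_partner
    have hn := β.partner_ne
    have hc := β.noncrossing x y
    -- Indices inside one of the two old links are linked inside it; this rules out every crossing
    -- with the new links.
    have hin : ∀ z, β.partner a < z → z < a → β.partner a < β.partner z ∧ β.partner z < a := by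
      intro z h1 h2
      have := β.partner_mem_Ioo (u := β.partner a) h1 (by rwa [hp])
      rwa [hp] at this
    have hin' : ∀ z, b < z → z < β.partner b → b < β.partner z ∧ β.partner z < β.partner b :=
      fun z h1 h2 => β.partner_mem_Ioo h1 h2
    have hx1 := hin x
    have hx2 := hin (β.partner x)
    have hx3 := hin' x
    have hx4 := hin' (β.partner x)
    have hy1 := hin y
    have hy2 := hin (β.partner y)
    have hy3 := hin' y
    have hy4 := hin' (β.partner y)
    rw [hp] at hx2 hx4 hy2 hy4
    have hi : ∀ z w, β.partner z = w → z = β.partner w := fun z w => (β.partner_eq_iff).1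
    have i1 := hi x a
    have i2 := hi x b
    have i3 := hi y a
    have i4 := hi y b
    clear hi hin hin' hp hn
    simp only [rewire, Fin.ext_iff, Fin.lt_def] at *
    split_ifs at hyx hcr <;> omega

/-- Turns the peak at the neighbouring indices `a`, `b` into a valley, where `c` is the left
endpoint of the innermost link around it. -/
def down (a b c : Fin (2 * N)) (hab : b.val = a.val + 1) (ha : β.partner a = b)
    (hca : c < a) (hc : b < β.partner c)
    (hmax : ∀ z, c < z → z < a → β.partner z < a) : LinkPattern N where
  partner := rewire β.partner a c
  partner_partner := β.rewire_rewire_apply (by omega)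
  partner_ne := β.rewire_ne hca.ne'
  noncrossing := by
    intro x y hxy hyx hcr
    have hp := β.partner_partner
    have hpb : β.partner b = a := by rw [← ha, hp]
    have hnc := β.noncrossing x y
    have hin : ∀ z, c < z → z < β.partner c → c < β.partner z ∧ β.partner z < β.partner c :=
      fun z h1 h2 => β.partner_mem_Ioo h1 h2
    have hx1 := hin x
    have hx2 := hin (β.partner x)
    have hx3 := hmax x
    have hx4 := hmax (β.partner x)
    have hy1 := hin y
    have hy2 := hin (β.partner y)
    have hy3 := hmax y
    have hy4 := hmax (β.partner y)
    rw [hp] at hx2 hx4 hy2 hy4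
    have hi : ∀ z w, β.partner z = w → z = β.partner w := fun z w => (β.partner_eq_iff).1
    have i1 := hi x a
    have i2 := hi x b
    have i3 := hi y a
    have i4 := hi y b
    have i5 := hi x c
    have i6 := hi y c
    rw [hpb] at i2 i4
    rw [ha] at i1 i3
    clear hi hin hp hmax
    simp only [rewire, ha, Fin.ext_iff, Fin.lt_def] at *
    split_ifs at hyx hcr <;> omega

/-- The path of `β.up` is that of `β` with the valley replaced by a peak. -/
theorem height_up {a b : Fin (2 * N)} (hab : b.val = a.val + 1) (ha : β.partner a < a)
    (hb : b < β.partner b) {k : ℕ} (hk : k ≤ 2 * N) :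
    (β.up a b hab ha hb).height k = β.height k + if k = b.val then 2 else 0 := by
  set γ := β.up a b hab ha hb with hγ
  have ga : γ.partner a = b := by simp [hγ, up, rewire]
  have gb : γ.partner b = a := by rw [← ga, γ.partner_partner]
  have hp := β.partner_partner
  have gs : ∀ x, x ≠ a → x ≠ b → (x < γ.partner x ↔ x < β.partner x) := by
    intro x h1 h2
    clear ga gb
    have hi : ∀ z w, β.partner z = w → z = β.partner w := fun z w => (β.partner_eq_iff).1
    have hi' : ∀ z w, z = β.partner w → β.partner z = w := fun z w => (β.partner_eq_iff).2
    have j1 := hi' x a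
    have j2 := hi' x b
    clear hi'
    have i1 := hi x a
    have i2 := hi x b
    simp only [hγ, up, rewire, Fin.ext_iff, Fin.lt_def] at *
    split_ifs <;> omega
  induction k with
  | zero => simp [height_zero, hab]
  | succ k ih =>
    have ih := ih (by omega)
    have hbv := b.isLt
    by_cases h1 : k = a.val
    · subst h1
      have e1 := γ.height_succ_of_lt (a := a) (by rw [ga, Fin.lt_def]; omega)
      have e2 := β.height_succ_of_gt ha
      rw [if_neg (by omega)] at ih
      rw [if_pos (by omega)]
      omega
    by_cases h2 : k = b.val
    · subst h2
      have e1 := γ.height_succ_of_gt (a := b) (by rw [gb, Fin.lt_def]; omega)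
      have e2 := β.height_succ_of_lt hb
      rw [if_pos (by omega)] at ih
      rw [if_neg (by omega)]
      omega
    rw [if_neg (by omega)] at ih ⊢
    obtain ⟨x, rfl⟩ : ∃ x : Fin (2 * N), x.val = k := ⟨⟨k, by omega⟩, rfl⟩
    have := gs x (fun h => h1 (by rw [h])) (fun h => h2 (by rw [h]))
    rcases β.lt_or_gt x with h | h
    · have e1 := β.height_succ_of_lt h
      have e2 := γ.height_succ_of_lt (this.2 h)
      omega
    · have e1 := β.height_succ_of_gt h
      have e2 := γ.height_succ_of_gt ((γ.lt_or_gt x).resolve_left (fun h' => by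
        have := this.1 h'; omega))
      omega

/-- A peak above a path that has no peak there is enclosed by a link. -/
theorem exists_enclosing {a b : Fin (2 * N)} (hab : b.val = a.val + 1)
    (ha : β.partner a = b) (hβ : α.Below β) (hα : α.partner a ≠ b) :
    ∃ c, c < a ∧ b < β.partner c ∧ ∀ z, c < z → z < a → β.partner z < a := by
  -- If `β` started its peak at height 0, then `α`, squeezed between 0 and `β`, would have the same
  -- peak.
  have hpos : β.height a.val ≠ 0 := by
    intro h0
    have hav := a.isLt
    have hbv := b.isLt
    have hba : β.partner b = a := by rw [← ha, β.partner_partner]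
    have e1 := β.height_succ_of_lt (a := a) (by rw [ha, Fin.lt_def]; omega)
    have e2 := β.height_succ_of_gt (a := b) (by rw [hba, Fin.lt_def]; omega)
    have l1 := hβ a.val (by omega)
    have l2 := hβ (b.val + 1) (by omega)
    rw [← hab] at e1
    rcases α.lt_or_gt a with h | h
    · rcases α.lt_or_gt b with h' | h'
      · have e3 := α.height_succ_of_lt h
        have e4 := α.height_succ_of_lt h'
        rw [← hab] at e3
        omega
      · exact hα (α.partner_eq_of_peak hab h h')
    · have e3 := α.height_succ_of_gt h
      omega
  rw [height, Finset.card_ne_zero] at hpos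
  -- The links still open at `a`; the innermost one has the largest left endpoint.
  set S := Finset.univ.filter fun i : Fin (2 * N) => i.val < a.val ∧ a.val ≤ (β.partner i).val
  have hc := S.max'_mem hpos
  set c := S.max' hpos
  have key : ∀ i : Fin (2 * N), i.val < a.val → a.val ≤ (β.partner i).val →
      b < β.partner i := by
    intro i h1 h2
    have h3 : (β.partner i).val ≠ a.val := by
      intro e
      have := (β.partner_eq_iff).1 (Fin.ext e)
      rw [ha] at this
      subst this
      omega
    have h4 : (β.partner i).val ≠ b.val := by
      intro e
      have := (β.partner_eq_iff).1 (Fin.ext e)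
      rw [← ha, β.partner_partner] at this
      subst this
      omega
    rw [Fin.lt_def]
    omega
  simp only [S, Finset.mem_filter, Finset.mem_univ, true_and] at hc
  refine ⟨c, hc.1, key c hc.1 hc.2, fun z h1 h2 => ?_⟩
  by_contra h3
  have : z ∈ S := by simp only [S, Finset.mem_filter, Finset.mem_univ, true_and]; omega
  exact absurd (S.le_max' z this) (not_le.2 h1)

end LinkPattern

section

/-! ### Tilings and removal of a single box -/

theorem IsDyckTile.eq_of_mem {t : Finset (ℕ × ℕ)} (ht : IsDyckTile t) {k y z : ℕ}
    (h1 : (k, y) ∈ t) (h2 : (k, z) ∈ t) : y = z := by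
  obtain ⟨x, x', h, -, -, -, -, rfl⟩ := ht
  simp only [Finset.mem_image, Prod.mk.injEq] at h1 h2
  obtain ⟨_, -, rfl, rfl⟩ := h1
  obtain ⟨_, -, rfl, rfl⟩ := h2
  rfl

theorem IsDyckTile.step {t : Finset (ℕ × ℕ)} (ht : IsDyckTile t) {k y z : ℕ}
    (h1 : (k, y) ∈ t) (h2 : (k + 1, z) ∈ t) : z = y + 1 ∨ y = z + 1 := by
  obtain ⟨x, x', h, -, -, -, hs, rfl⟩ := ht
  simp only [Finset.mem_image, Prod.mk.injEq, Finset.mem_Icc] at h1 h2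
  obtain ⟨_, h3, rfl, rfl⟩ := h1
  obtain ⟨_, h4, rfl, rfl⟩ := h2
  exact hs _ h3.1 (by omega)

theorem isDyckTile_singleton (c : ℕ × ℕ) : IsDyckTile {c} :=
  ⟨c.1, c.1, fun _ => c.2, le_rfl, rfl, fun _ _ _ => le_rfl, fun k h1 h2 => by omega, by simp⟩

/-- A Dyck tile with at least two boxes that contains a local maximum of the heights contains the
boxes on both sides of it. -/
theorem IsDyckTile.neighbours_of_peak {t : Finset (ℕ × ℕ)} (ht : IsDyckTile t) {k y : ℕ}
    (hmem : (k + 1, y) ∈ t) (hne : t ≠ {(k + 1, y)})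
    (hl : (k, y + 1) ∉ t) (hr : (k + 2, y + 1) ∉ t) :
    ∃ z, y = z + 1 ∧ (k, z) ∈ t ∧ (k + 2, z) ∈ t := by
  obtain ⟨x, x', h, hx, he, hge, hs, rfl⟩ := ht
  simp only [Finset.mem_image, Prod.mk.injEq, Finset.mem_Icc, not_exists, not_and] at hmem hl hr ⊢
  obtain ⟨_, ⟨h1, h2⟩, rfl, rfl⟩ := hmem
  have hleft : x ≤ k → h (k + 1) = h k + 1 := fun hk => by
    rcases hs k hk (by omega) with h3 | h3
    · exact h3
    · exact absurd h3 (hl k ⟨hk, by omega⟩ rfl)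
  have hright : k + 1 < x' → h (k + 1) = h (k + 2) + 1 := fun hk => by
    rcases hs (k + 1) h1 hk with h3 | h3
    · exact absurd h3 (hr (k + 2) ⟨by omega, by omega⟩ rfl)
    · exact h3
  -- A tile of several boxes that began or ended at the peak would go below its initial height.
  have hxk : x ≤ k := by
    by_contra hxk
    have hxe : x = k + 1 := by omega
    by_cases hk : k + 1 < x'
    · have := hright hk
      have := hge (k + 2) (by omega) (by omega)
      rw [hxe] at this
      omega
    · apply hne
      have hxe' : x' = k + 1 := by omega
      rw [hxe, hxe']
      simp
  have hk : k + 1 < x' := by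
    by_contra hk
    have hxe' : x' = k + 1 := by omega
    have := hleft hxk
    have := hge k hxk (by omega)
    rw [hxe'] at he
    omega
  have h3 := hleft hxk
  have h4 := hright hk
  exact ⟨h k, h3, ⟨k, ⟨hxk, by omega⟩, rfl, rfl⟩, ⟨k + 2, ⟨by omega, by omega⟩, rfl, by omega⟩⟩

theorem mem_columns {t : Finset (ℕ × ℕ)} {k : ℕ} : k ∈ columns t ↔ ∃ y, (k, y) ∈ t := by
  simp [columns]

variable {N : ℕ} {α β : LinkPattern N}

theorem mem_skewBoxes {k y : ℕ} :
    (k, y) ∈ skewBoxes α β ↔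
      k ≤ 2 * N ∧ Odd (k + y) ∧ α.height k < y ∧ y < β.height k := by
  have := β.height_le k
  simp only [skewBoxes, Finset.mem_filter, Finset.mem_product, Finset.mem_range]
  constructor
  · rintro ⟨⟨h1, h2⟩, h3, h4, h5⟩
    exact ⟨by omega, h3, h4, h5⟩
  · rintro ⟨h1, h3, h4, h5⟩
    exact ⟨⟨by omega, by omega⟩, h3, h4, h5⟩

theorem IsCoverInclusiveTiling.mem_powerset {T : Finset (Finset (ℕ × ℕ))}
    (hT : IsCoverInclusiveTiling α β T) : T ∈ (skewBoxes α β).powerset.powerset := by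
  rw [Finset.mem_powerset]
  intro t ht
  rw [Finset.mem_powerset, ← hT.2.2.1]
  exact Finset.subset_biUnion_of_mem id ht

theorem IsCoverInclusiveTiling.subset {T : Finset (Finset (ℕ × ℕ))}
    (hT : IsCoverInclusiveTiling α β T) {t : Finset (ℕ × ℕ)} (ht : t ∈ T) :
    t ⊆ skewBoxes α β :=
  Finset.mem_powerset.1 (Finset.mem_powerset.1 hT.mem_powerset ht)

/-- The path `α` without a peak at `a`, `b` that passes below two boxes beside `a`, `b` also passes
below the box straight between and below them. -/
theorem LinkPattern.height_mid_lt (α : LinkPattern N) {a b : Fin (2 * N)}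
    (hab : b.val = a.val + 1) (hα : α.partner a ≠ b) {y : ℕ} (hy : Even (y + a.val))
    (h1 : α.height a.val < y + 1) (h2 : α.height (a.val + 2) < y + 1) :
    α.height (a.val + 1) < y := by
  have hav := a.isLt
  have p1 := α.even_height_add (k := a.val) (by omega)
  rw [Nat.even_iff] at *
  rcases α.lt_or_gt a with h | h
  · rcases α.lt_or_gt b with h' | h'
    · have e3 := α.height_succ_of_lt h
      have e4 := α.height_succ_of_lt h'
      rw [hab] at e4
      have : a.val + 1 + 1 = a.val + 2 := rfl
      rw [this] at e4
      omega
    · exact absurd (α.partner_eq_of_peak hab h h') hα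
  · have e3 := α.height_succ_of_gt h
    omega

/-- In a cover-inclusive tiling above a path without a peak at `a`, `b`, no tile has a peak
there. -/
theorem IsCoverInclusiveTiling.no_peak {T : Finset (Finset (ℕ × ℕ))}
    (hT : IsCoverInclusiveTiling α β T) {a b : Fin (2 * N)}
    (hab : b.val = a.val + 1) (hα : α.partner a ≠ b) (y : ℕ) :
    ∀ t ∈ T, ¬ ((a.val, y) ∈ t ∧ (a.val + 1, y + 1) ∈ t ∧ (a.val + 2, y) ∈ t) := by
  induction y using Nat.strong_induction_on with
  | _ y ih =>
  rintro t ht ⟨h1, h2, h3⟩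
  obtain ⟨hd, hdisj, hU, hcov⟩ := id hT
  have m1 := mem_skewBoxes.1 (hT.subset ht h1)
  have m2 := mem_skewBoxes.1 (hT.subset ht h2)
  have m3 := mem_skewBoxes.1 (hT.subset ht h3)
  obtain ⟨z, rfl⟩ : ∃ z, y = z + 1 := ⟨y - 1, by omega⟩
  have o1 := Nat.odd_iff.1 m1.2.1
  -- The box straight below the peak is in the diagram. Its tile is covered by `t`, so it meets all
  -- three columns and, being disjoint from `t`, has a lower peak there: an infinite descent.
  have hlt := α.height_mid_lt hab hα (y := z) (by rw [Nat.even_iff]; omega) m1.2.2.1 m3.2.2.1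
  have hbox : (a.val + 1, z) ∈ T.biUnion id := by
    rw [hU, mem_skewBoxes]
    exact ⟨m2.1, by rw [Nat.odd_iff]; omega, hlt, by omega⟩
  obtain ⟨u, hu, h4⟩ := Finset.mem_biUnion.1 hbox
  simp only [id] at h4
  have hne : t ≠ u := by
    rintro rfl
    have := (hd t ht).eq_of_mem h2 h4
    omega
  have hsub := hcov t ht u hu hne ⟨_, h2, _, h4, rfl, by simp⟩
  obtain ⟨v, hv⟩ := mem_columns.1 (hsub (mem_columns.2 ⟨_, h1⟩))
  obtain ⟨w, hw⟩ := mem_columns.1 (hsub (mem_columns.2 ⟨_, h3⟩))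
  have hdis := Finset.disjoint_left.1 (hdisj t ht u hu hne)
  have hv' : v ≠ z + 1 := by rintro rfl; exact hdis h1 hv
  have hw' : w ≠ z + 1 := by rintro rfl; exact hdis h3 hw
  have s1 := (hd u hu).step hv h4
  have s2 := (hd u hu).step h4 hw
  obtain rfl : z = v + 1 := by omega
  obtain rfl : w = v := by omega
  exact ih w (by omega) u hu ⟨hv, h4, hw⟩

/-- Filling a valley of the upper path adds one box to the skew diagram. -/
theorem skewBoxes_up {a b : Fin (2 * N)} (hab : b.val = a.val + 1)
    (ha : β.partner a < a) (hb : b < β.partner b) (hβ : α.Below β) :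
    skewBoxes α (β.up a b hab ha hb) =
      insert (a.val + 1, β.height a.val) (skewBoxes α β) := by
  have hav := a.isLt
  have hbv := b.isLt
  have e1 := β.height_succ_of_gt ha
  have e2 := β.height_succ_of_lt hb
  have p1 := Nat.even_iff.1 (β.even_height_add (k := a.val) (by omega))
  have l1 := hβ (a.val + 1) (by omega)
  ext ⟨k, y⟩
  rw [Finset.mem_insert, mem_skewBoxes, mem_skewBoxes, Prod.mk.injEq]
  by_cases hk : k ≤ 2 * N
  · rw [β.height_up hab ha hb hk]
    by_cases hkb : k = a.val + 1
    · subst hkb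
      rw [if_pos hab.symm, Nat.odd_iff]
      omega
    · rw [if_neg (by omega)]
      simp [hkb]
  · constructor
    · rintro ⟨h, -⟩; omega
    · rintro (⟨h, -⟩ | ⟨h, -⟩) <;> omega

theorem notMem_skewBoxes_valley {a : Fin (2 * N)} (ha : β.partner a < a) {y : ℕ}
    (hy : β.height a.val ≤ y) : (a.val + 1, y) ∉ skewBoxes α β := by
  rw [mem_skewBoxes]
  have e1 := β.height_succ_of_gt ha
  omega

/-- The new box is the highest of its column: no tile covers it, and its single column lies in the
extent of every tile that it covers. -/
theorem IsCoverInclusiveTiling.insert_box {T : Finset (Finset (ℕ × ℕ))}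
    (hT : IsCoverInclusiveTiling α β T) {a b : Fin (2 * N)}
    (hab : b.val = a.val + 1)
    (ha : β.partner a < a) (hb : b < β.partner b) (hβ : α.Below β) :
    IsCoverInclusiveTiling α (β.up a b hab ha hb)
      (insert {(a.val + 1, β.height a.val)} T) := by
  obtain ⟨hd, hdisj, hU, hcov⟩ := id hT
  have hnot : ∀ t ∈ T, ∀ y, β.height a.val ≤ y → (a.val + 1, y) ∉ t := fun t ht y hy h =>
    notMem_skewBoxes_valley ha hy (hT.subset ht h)
  refine ⟨?_, ?_, ?_, ?_⟩
  · simp only [Finset.mem_insert, forall_eq_or_imp]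
    exact ⟨isDyckTile_singleton _, hd⟩
  · simp only [Finset.mem_insert, forall_eq_or_imp]
    refine ⟨⟨fun h => absurd rfl h, fun u hu _ => ?_⟩, fun t ht => ⟨fun _ => ?_, hdisj t ht⟩⟩
    · simpa using hnot u hu _ le_rfl
    · simpa using hnot t ht _ le_rfl
  · rw [Finset.biUnion_insert, hU, skewBoxes_up hab ha hb hβ]
    rfl
  · simp only [Finset.mem_insert, forall_eq_or_imp]
    refine ⟨⟨fun h => absurd rfl h, fun u hu _ => ?_⟩, fun t ht => ⟨fun _ => ?_, hcov t ht⟩⟩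
    · rintro ⟨c, hc, ⟨k, e⟩, he, h1, -⟩
      rw [Finset.mem_singleton] at hc
      subst hc
      simp only at h1
      subst h1
      intro k hk
      simp only [columns, Finset.image_singleton, Finset.mem_singleton] at hk
      subst hk
      exact mem_columns.2 ⟨_, he⟩
    · rintro ⟨⟨k, y⟩, hc, e, he, h1, h2⟩
      rw [Finset.mem_singleton] at he
      subst he
      simp only at h1 h2
      subst h1
      exact absurd hc (hnot t ht _ h2.le)

/-- The new box is at the top of the diagram, so a larger tile through it would have a peak there,
which `no_peak` excludes. -/
theorem IsCoverInclusiveTiling.box_mem {a b : Fin (2 * N)}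
    (hab : b.val = a.val + 1) (hα : α.partner a ≠ b)
    (ha : β.partner a < a) (hb : b < β.partner b) (hβ : α.Below β)
    {T : Finset (Finset (ℕ × ℕ))}
    (hT : IsCoverInclusiveTiling α (β.up a b hab ha hb) T) :
    {(a.val + 1, β.height a.val)} ∈ T := by
  have hav := a.isLt
  have hbv := b.isLt
  have hbox : (a.val + 1, β.height a.val) ∈ T.biUnion id := by
    rw [hT.2.2.1, skewBoxes_up hab ha hb hβ]
    exact Finset.mem_insert_self _ _
  obtain ⟨t, ht, hmem⟩ := Finset.mem_biUnion.1 hbox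
  simp only [id] at hmem
  by_contra hne
  have hne' : t ≠ {(a.val + 1, β.height a.val)} := by
    rintro rfl; exact hne ht
  have e1 := β.height_succ_of_gt ha
  have e2 := β.height_succ_of_lt hb
  rw [hab] at e2
  obtain ⟨z, hz, h1, h2⟩ := (hT.1 t ht).neighbours_of_peak hmem hne'
    (fun h => by
      have := (mem_skewBoxes.1 (hT.subset ht h)).2.2.2
      rw [β.height_up hab ha hb (by omega), if_neg (by omega)] at this
      omega)
    (fun h => by
      have := (mem_skewBoxes.1 (hT.subset ht h)).2.2.2
      rw [β.height_up hab ha hb (by omega), if_neg (by omega)] at this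
      have e3 : a.val + 1 + 1 = a.val + 2 := rfl
      rw [e3] at e2
      omega)
  rw [hz] at hmem
  exact hT.no_peak hab hα z t ht ⟨h1, hmem, h2⟩

theorem IsCoverInclusiveTiling.erase_box {a b : Fin (2 * N)}
    (hab : b.val = a.val + 1) (hα : α.partner a ≠ b)
    (ha : β.partner a < a) (hb : b < β.partner b) (hβ : α.Below β)
    {T : Finset (Finset (ℕ × ℕ))}
    (hT : IsCoverInclusiveTiling α (β.up a b hab ha hb) T) :
    IsCoverInclusiveTiling α β (T.erase {(a.val + 1, β.height a.val)}) := by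
  have hm := hT.box_mem hab hα ha hb hβ
  obtain ⟨hd, hdisj, hU, hcov⟩ := hT
  refine ⟨fun t ht => hd t (Finset.mem_of_mem_erase ht),
    fun t ht u hu => hdisj t (Finset.mem_of_mem_erase ht) u (Finset.mem_of_mem_erase hu), ?_,
    fun t ht u hu => hcov t (Finset.mem_of_mem_erase ht) u (Finset.mem_of_mem_erase hu)⟩
  rw [skewBoxes_up hab ha hb hβ, ← Finset.insert_erase hm, Finset.biUnion_insert, id,
    ← Finset.insert_eq] at hU
  have hn : (a.val + 1, β.height a.val) ∉
      (T.erase {(a.val + 1, β.height a.val)}).biUnion id := by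
    simp only [Finset.mem_biUnion, id, not_exists, not_and]
    intro t ht
    have := hdisj _ hm t (Finset.mem_of_mem_erase ht) (Finset.ne_of_mem_erase ht).symm
    simpa using this
  have := congrArg (fun S => Finset.erase S (a.val + 1, β.height a.val)) hU
  simpa only [Finset.erase_insert hn,
    Finset.erase_insert (notMem_skewBoxes_valley (α := α) ha le_rfl)] using this

/-- Filling a valley of the upper path, where the lower path has no peak, does not change the
number of cover-inclusive Dyck tilings. -/
theorem tilingCount_up {a b : Fin (2 * N)} (hab : b.val = a.val + 1) (hα : α.partner a ≠ b)
    (ha : β.partner a < a) (hb : b < β.partner b) (hβ : α.Below β) :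
    tilingCount α (β.up a b hab ha hb) = tilingCount α β := by
  classical
  symm
  have hnot : ∀ T, IsCoverInclusiveTiling α β T → {(a.val + 1, β.height a.val)} ∉ T :=
    fun T hT h => notMem_skewBoxes_valley ha le_rfl (hT.subset h (Finset.mem_singleton_self _))
  unfold tilingCount
  refine Finset.card_bij' (fun T _ => insert {(a.val + 1, β.height a.val)} T)
    (fun T _ => T.erase {(a.val + 1, β.height a.val)}) ?_ ?_ ?_ ?_
  · intro T hT
    have h := ((Finset.mem_filter.1 hT).2.insert_box hab ha hb hβ)
    exact Finset.mem_filter.2 ⟨h.mem_powerset, h⟩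
  · intro T hT
    have h := ((Finset.mem_filter.1 hT).2.erase_box hab hα ha hb hβ)
    exact Finset.mem_filter.2 ⟨h.mem_powerset, h⟩
  · intro T hT
    exact Finset.erase_insert (hnot T (Finset.mem_filter.1 hT).2)
  · intro T hT
    exact Finset.insert_erase ((Finset.mem_filter.1 hT).2.box_mem hab hα ha hb hβ)

end

section

/-! ### Antisymmetry -/

variable {N : ℕ}

/-- If exchanging indices turns the left endpoints of `β` into those of `γ`, and the right
endpoints as well up to one transposition, then the determinants differ by a sign. -/
theorem fominDet_perm (𝔎 : Fin (2 * N) → Fin (2 * N) → ℂ) {β γ : LinkPattern N}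
    (σ : Equiv.Perm (Fin (2 * N)))
    (hσ : ∀ x, σ x < γ.partner (σ x) ↔ x < β.partner x) {u v : Fin (2 * N)} (huv : u ≠ v)
    (hu : u < β.partner u) (hv : v < β.partner v)
    (h : ∀ y, y < β.partner y → γ.partner (σ (Equiv.swap u v y)) = σ (β.partner y)) :
    fominDet (fun a b => 𝔎 (σ a) (σ b)) β = - fominDet 𝔎 γ := by
  let e : {i : Fin (2 * N) // i < β.partner i} ≃ {i : Fin (2 * N) // i < γ.partner i} :=
    σ.subtypeEquiv fun x => (hσ x).symm
  -- Relabelling rows and columns simultaneously by `e` costs no sign; only the additional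
  -- transposition of columns does.
  have key : (Matrix.of fun a b : {i : Fin (2 * N) // i < β.partner i} =>
      𝔎 (σ a.val) (σ (β.partner b.val))) =
      ((Matrix.of fun a b : {i : Fin (2 * N) // i < γ.partner i} =>
        𝔎 a.val (γ.partner b.val)).submatrix e e).submatrix id
          (Equiv.swap (⟨u, hu⟩ : {i : Fin (2 * N) // i < β.partner i}) ⟨v, hv⟩) := by
    ext x y
    simp only [Matrix.of_apply, Matrix.submatrix_apply, id, e, Equiv.subtypeEquiv_apply]
    rw [← h y.val y.2]
    congr 3
    simp only [Equiv.swap_apply_def, Subtype.ext_iff]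
    split_ifs <;> rfl
  rw [fominDet, fominDet, key, Matrix.det_permute', Matrix.det_submatrix_equiv_self,
    Equiv.Perm.sign_swap (by simpa [Subtype.ext_iff] using huv)]
  simp

variable (𝔎 : Fin (2 * N) → Fin (2 * N) → ℂ) {α β : LinkPattern N} {a b : Fin (2 * N)}

theorem fominDet_swap_left (hab : a ≠ b) (ha : a < β.partner a) (hb : b < β.partner b) :
    fominDet (fun x y => 𝔎 (Equiv.swap a b x) (Equiv.swap a b y)) β = - fominDet 𝔎 β := by
  refine fominDet_perm 𝔎 (Equiv.swap a b) ?_ hab ha hb ?_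
  · intro x
    simp only [Equiv.swap_apply_def]
    split_ifs with h1 h2 <;> simp [*]
  · intro y hy
    have hp := β.partner_partner
    rw [Equiv.swap_apply_self]
    rw [Equiv.swap_apply_of_ne_of_ne]
    · rintro h
      rw [← h, hp] at ha
      exact ha.asymm hy
    · rintro h
      rw [← h, hp] at hb
      exact hb.asymm hy

theorem fominDet_swap_right (hab : a ≠ b) (ha : β.partner a < a) (hb : β.partner b < b) :
    fominDet (fun x y => 𝔎 (Equiv.swap a b x) (Equiv.swap a b y)) β = - fominDet 𝔎 β := by
  have hp := β.partner_partner
  have hi := β.partner_injective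
  refine fominDet_perm 𝔎 (Equiv.swap a b) (u := β.partner a) (v := β.partner b) ?_ ?_ ?_ ?_ ?_
  · intro x
    simp only [Equiv.swap_apply_def]
    split_ifs with h1 h2 <;> simp [*, ha.asymm, hb.asymm]
  · exact fun h => hab (hi h)
  · rwa [hp]
  · rwa [hp]
  · intro y hy
    have hya : y ≠ a := by rintro rfl; exact ha.asymm hy
    have hyb : y ≠ b := by rintro rfl; exact hb.asymm hy
    simp only [Equiv.swap_apply_def]
    grind

/-- The exchange carries left endpoints to left endpoints, but the right endpoints that belong to
`β.partner a` and `b` change places. -/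
theorem fominDet_swap_up (hab : b.val = a.val + 1) (ha : β.partner a < a)
    (hb : b < β.partner b) :
    fominDet (fun x y => 𝔎 (Equiv.swap a b x) (Equiv.swap a b y)) β =
      - fominDet 𝔎 (β.up a b hab ha hb) := by
  have hp := β.partner_partner
  have hi := β.partner_injective
  have hab' : a < b := by rw [Fin.lt_def]; omega
  refine fominDet_perm 𝔎 (Equiv.swap a b) (u := β.partner a) (v := b) ?_ (by omega)
    (by rwa [hp]) hb ?_
  · intro x
    have j1 := hp a
    have j2 := hp b
    have i1 := (β.partner_eq_iff (a := x) (b := a))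
    have i2 := (β.partner_eq_iff (a := x) (b := b))
    simp only [Equiv.swap_apply_def, LinkPattern.up, LinkPattern.rewire]
    split_ifs <;> grind
  · intro y hy
    have hya : y ≠ a := by rintro rfl; exact ha.asymm hy
    simp only [Equiv.swap_apply_def, LinkPattern.up, LinkPattern.rewire]
    grind

theorem fominDet_up_swap (hab : b.val = a.val + 1) (ha : β.partner a < a)
    (hb : b < β.partner b) :
    fominDet (fun x y => 𝔎 (Equiv.swap a b x) (Equiv.swap a b y)) (β.up a b hab ha hb) =
      - fominDet 𝔎 β := by
  have := fominDet_swap_up (fun x y => 𝔎 (Equiv.swap a b x) (Equiv.swap a b y)) hab ha hb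
  simp only [Equiv.swap_apply_self] at this
  rw [this, neg_neg]

/-! ### The bijection between valleys and peaks above `α` -/

namespace LinkPattern

theorem Below.up (hab : b.val = a.val + 1) (ha : β.partner a < a) (hb : b < β.partner b)
    (hβ : α.Below β) : α.Below (β.up a b hab ha hb) := fun k hk => by
  rw [β.height_up hab ha hb hk]
  exact (hβ k hk).trans (Nat.le_add_right _ _)

/-- Only the height at the summit decreases, and a path without a peak there that passes below both
neighbours also passes below the valley. -/
theorem Below.of_up (hab : b.val = a.val + 1) (hα : α.partner a ≠ b)
    (ha : β.partner a < a) (hb : b < β.partner b)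
    (hβ : α.Below (β.up a b hab ha hb)) : α.Below β := fun k hk => by
  have hav := a.isLt
  have hbv := b.isLt
  by_cases hkb : k = b.val
  · have h1 := hβ a.val (by omega)
    have h2 := hβ (b.val + 1) (by omega)
    rw [β.height_up hab ha hb (by omega), if_neg (by omega)] at h1 h2
    have e1 := β.height_succ_of_gt ha
    have e2 := β.height_succ_of_lt hb
    have e3 : b.val + 1 = a.val + 2 := by omega
    rw [← hab] at e1
    rw [e3] at e2 h2
    have p1 := Nat.even_iff.1 (β.even_height_add (k := a.val) (by omega))
    have := α.height_mid_lt hab hα (y := β.height a.val) (by rw [Nat.even_iff]; omega)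
      (by omega) (by omega)
    rw [hkb]
    rw [← hab] at this
    omega
  · have h1 := hβ k hk
    rwa [β.height_up hab ha hb hk, if_neg hkb] at h1

theorem up_partner_left (hab : b.val = a.val + 1) (ha : β.partner a < a)
    (hb : b < β.partner b) : (β.up a b hab ha hb).partner a = b := by
  simp [LinkPattern.up, rewire]

/-- The raised pattern of `γ` links `γ.partner a` to an index beyond `b`. If that index were inside
the link `{β.partner a, a}`, the raised pattern of `β` would link it to an index before `a`. -/
theorem not_lt_of_up_eq {γ : LinkPattern N} (hab : b.val = a.val + 1) (ha : β.partner a < a)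
    (hb : b < β.partner b) (ha' : γ.partner a < a) (hb' : b < γ.partner b)
    (h : β.up a b hab ha hb = γ.up a b hab ha' hb') : ¬ β.partner a < γ.partner a := by
  intro hlt
  have h1 := congrFun (congrArg partner h) (γ.partner a)
  have h2 := β.partner_mem_Ioo (u := β.partner a) hlt (by rwa [β.partner_partner])
  rw [β.partner_partner] at h2
  have hp := β.partner_partner (γ.partner a)
  have i1 := (β.partner_eq_iff (a := γ.partner a) (b := b))
  simp only [up, rewire] at h1
  grind

theorem up_injective {γ : LinkPattern N} (hab : b.val = a.val + 1) (ha : β.partner a < a)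
    (hb : b < β.partner b) (ha' : γ.partner a < a) (hb' : b < γ.partner b)
    (h : β.up a b hab ha hb = γ.up a b hab ha' hb') : β = γ := by
  have hc : β.partner a = γ.partner a :=
    le_antisymm (not_lt.1 (not_lt_of_up_eq hab ha' hb' ha hb h.symm))
      (not_lt.1 (not_lt_of_up_eq hab ha hb ha' hb' h))
  have key : ∀ z, rewire β.partner a b z = rewire γ.partner a b z := fun z =>
    congrFun (congrArg partner h) z
  have hβ := β.partner_partner
  have hγ := γ.partner_partner
  have hd : β.partner b = γ.partner b := by
    have := key (β.partner a)
    simp only [rewire] at this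
    grind
  ext1
  funext x
  have := key x
  simp only [rewire] at this
  grind

/-- Every peak above a path without a peak there comes from a valley. -/
theorem exists_up_eq (hab : b.val = a.val + 1) (hα : α.partner a ≠ b)
    (hβ : α.Below β) (h : β.partner a = b) :
    ∃ (γ : LinkPattern N) (ha : γ.partner a < a) (hb : b < γ.partner b),
      γ.up a b hab ha hb = β := by
  obtain ⟨c, hca, hc, hmax⟩ := α.exists_enclosing β hab h hβ hα
  have hp := β.partner_partner
  have hi := β.partner_injective
  have hab' : a < b := by rw [Fin.lt_def]; omega
  refine ⟨β.down a b c hab h hca hc hmax, ?_, ?_, ?_⟩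
  · simpa [down, rewire] using hca
  · have hb : (β.down a b c hab h hca hc hmax).partner b = β.partner c := by
      simp only [down, rewire]; grind
    rwa [hb]
  · ext1
    funext x
    simp only [up, down, rewire]
    grind

end LinkPattern

open Classical in
theorem sum_valley_eq_sum_peak (hab : b.val = a.val + 1) (hα : α.partner a ≠ b)
    (f g : LinkPattern N → ℂ)
    (h : ∀ β (ha : β.partner a < a) (hb : b < β.partner b), α.Below β →
      f β = g (β.up a b hab ha hb)) :
    ∑ β with α.Below β ∧ β.partner a < a ∧ b < β.partner b, f β =
      ∑ β with α.Below β ∧ β.partner a = b, g β := by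
  refine Finset.sum_bij
    (fun β hβ => β.up a b hab (Finset.mem_filter.1 hβ).2.2.1 (Finset.mem_filter.1 hβ).2.2.2)
    ?_ ?_ ?_ ?_
  · intro β hβ
    have h := (Finset.mem_filter.1 hβ).2
    exact Finset.mem_filter.2 ⟨Finset.mem_univ _, h.1.up hab h.2.1 h.2.2,
      LinkPattern.up_partner_left hab h.2.1 h.2.2⟩
  · intro β hβ γ hγ he
    have h := (Finset.mem_filter.1 hβ).2
    have h' := (Finset.mem_filter.1 hγ).2
    exact LinkPattern.up_injective hab h.2.1 h.2.2 h'.2.1 h'.2.2 he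
  · intro β hβ
    have h := (Finset.mem_filter.1 hβ).2
    obtain ⟨γ, ha, hb, rfl⟩ := LinkPattern.exists_up_eq hab hα h.1 h.2
    exact ⟨γ, Finset.mem_filter.2 ⟨Finset.mem_univ _, h.1.of_up hab hα ha hb, ha, hb⟩, rfl⟩
  · intro β hβ
    have h' := (Finset.mem_filter.1 hβ).2
    exact h β _ _ h'.1

open Classical in
theorem sum_below_eq (hab : b.val = a.val + 1) (f : LinkPattern N → ℂ) :
    ∑ β with α.Below β, f β =
      ∑ β with α.Below β ∧ β.partner a < a ∧ b < β.partner b, f β +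
      ∑ β with α.Below β ∧ β.partner a = b, f β +
      ∑ β with α.Below β ∧ ¬ (β.partner a < a ∧ b < β.partner b) ∧ β.partner a ≠ b, f β := by
  rw [add_assoc, ← Finset.sum_filter_add_sum_filter_not _
    (fun β : LinkPattern N => β.partner a < a ∧ b < β.partner b), Finset.filter_filter]
  congr 1
  rw [← Finset.sum_filter_add_sum_filter_not _ (fun β : LinkPattern N => β.partner a = b)]
  simp only [Finset.filter_filter]
  congr 2
  · ext β
    simp only [Finset.mem_filter, Finset.mem_univ, true_and]
    constructor
    · exact fun h => ⟨h.1.1, h.2⟩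
    · exact fun h => ⟨⟨h.1, fun h' => by rw [h.2] at h'; have := Fin.lt_def.1 h'.1; omega⟩, h.2⟩
  · ext β
    simp only [and_assoc, ne_eq]

open Classical in
/-- The inverse Fomin type sum changes its sign when two neighbouring indices that are not linked
are exchanged in the kernel. -/
theorem inverseFominSum_swap (hab : b.val = a.val + 1) (hα : α.partner a ≠ b) :
    inverseFominSum (fun x y => 𝔎 (Equiv.swap a b x) (Equiv.swap a b y)) α =
      - inverseFominSum 𝔎 α := by
  have hne : a ≠ b := by rintro rfl; omega
  unfold inverseFominSum
  have e1 := sum_valley_eq_sum_peak hab hα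
    (fun β => (tilingCount α β : ℂ) *
      fominDet (fun x y => 𝔎 (Equiv.swap a b x) (Equiv.swap a b y)) β)
    (fun β => - ((tilingCount α β : ℂ) * fominDet 𝔎 β)) fun β ha hb hβ => by
      rw [fominDet_swap_up 𝔎 hab ha hb, tilingCount_up hab hα ha hb hβ, mul_neg]
  have e2 := sum_valley_eq_sum_peak hab hα
    (fun β => - ((tilingCount α β : ℂ) * fominDet 𝔎 β))
    (fun β => (tilingCount α β : ℂ) *
      fominDet (fun x y => 𝔎 (Equiv.swap a b x) (Equiv.swap a b y)) β) fun β ha hb hβ => by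
      rw [fominDet_up_swap, tilingCount_up hab hα ha hb hβ, mul_neg]
  -- In the remaining patterns `a` and `b` are both left or both right endpoints.
  have e3 : ∑ β with α.Below β ∧ ¬ (β.partner a < a ∧ b < β.partner b) ∧ β.partner a ≠ b,
      (tilingCount α β : ℂ) * fominDet (fun x y => 𝔎 (Equiv.swap a b x) (Equiv.swap a b y)) β =
      ∑ β with α.Below β ∧ ¬ (β.partner a < a ∧ b < β.partner b) ∧ β.partner a ≠ b,
        - ((tilingCount α β : ℂ) * fominDet 𝔎 β) := by
    refine Finset.sum_congr rfl fun β hβ => ?_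
    obtain ⟨-, h1, h2⟩ := (Finset.mem_filter.1 hβ).2
    rw [← mul_neg]
    congr 1
    rcases β.lt_or_gt a with ha | ha <;> rcases β.lt_or_gt b with hb | hb
    · exact fominDet_swap_left 𝔎 hne ha hb
    · exact absurd (β.partner_eq_of_peak hab ha hb) h2
    · exact absurd ⟨ha, hb⟩ h1
    · exact fominDet_swap_right 𝔎 hne ha hb
  rw [Finset.sum_neg_distrib] at e1 e2 e3
  rw [sum_below_eq hab, sum_below_eq hab (fun β => (tilingCount α β : ℂ) * fominDet 𝔎 β)]
  linear_combination e1 - e2 + e3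

end

section

/-! ### Dependence on the entries of a block -/

section Cofactor

variable {n R : Type*} [Fintype n] [DecidableEq n] [CommRing R]

/-- A cofactor ignores its own row and column, so both may be replaced freely. -/
theorem adjugate_congr {A B : Matrix n n R} {i j : n}
    (h : ∀ x y, x ≠ i → y ≠ j → A x y = B x y) : A.adjugate j i = B.adjugate j i := by
  have hcol : ∀ M : Matrix n n R, M.adjugate j i = (M.updateCol j (Pi.single i 1)).det := by
    intro M
    rw [← Matrix.transpose_apply M.adjugate, Matrix.adjugate_transpose, Matrix.adjugate_apply,
      Matrix.updateRow_transpose, Matrix.det_transpose]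
  have h1 : A.adjugate j i = (A.updateRow i (B i)).adjugate j i := by
    rw [Matrix.adjugate_apply, Matrix.adjugate_apply, Matrix.updateRow_idem]
  rw [h1, hcol, hcol]
  congr 1
  ext x y
  by_cases hy : y = j
  · subst hy
    simp
  · by_cases hx : x = i
    · subst hx
      simp [hy]
    · simp [hx, hy, h x y hx hy]

theorem det_updateRow_add_single (A : Matrix n n R) (i j : n) (z : R) :
    (A.updateRow i (A i + z • Pi.single j 1)).det = A.det + z * A.adjugate j i := by
  rw [Matrix.det_updateRow_add, Matrix.updateRow_eq_self, Matrix.det_updateRow_smul,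
    Matrix.adjugate_apply]

end Cofactor

variable {N : ℕ}

/-- The kernel with the entries at `(a, b)` and `(b, a)` replaced by `z`. -/
def setLink (𝔎 : Fin (2 * N) → Fin (2 * N) → ℂ) (a b : Fin (2 * N)) (z : ℂ)
    (x y : Fin (2 * N)) : ℂ :=
  if x = a ∧ y = b ∨ x = b ∧ y = a then z else 𝔎 x y

theorem setLink_comm (𝔎 : Fin (2 * N) → Fin (2 * N) → ℂ) (a b : Fin (2 * N)) (z : ℂ) :
    setLink 𝔎 a b z = setLink 𝔎 b a z := by
  funext x y
  simp only [setLink, or_comm]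

/-- The index `a` occurs only as a row and `b` only as a column, so `z` is a single matrix entry,
and its coefficient is a cofactor without that row and column. -/
theorem fominDet_setLink_of_left_right (𝔎 𝔎' : Fin (2 * N) → Fin (2 * N) → ℂ)
    {a b : Fin (2 * N)}
    (h : ∀ x y, x ≠ a → y ≠ a → x ≠ b → y ≠ b → 𝔎 x y = 𝔎' x y) (z : ℂ) {β : LinkPattern N}
    (ha : a < β.partner a) (hb : β.partner b < b) :
    fominDet (setLink 𝔎 a b z) β - fominDet (setLink 𝔎 a b 0) β =
      fominDet (setLink 𝔎' a b z) β - fominDet (setLink 𝔎' a b 0) β := by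
  have hne : a ≠ b := by rintro rfl; exact ha.asymm hb
  have hp := β.partner_partner
  let i : {i : Fin (2 * N) // i < β.partner i} := ⟨a, ha⟩
  let k : {i : Fin (2 * N) // i < β.partner i} := ⟨β.partner b, by rwa [hp]⟩
  have hleft : ∀ x : {i : Fin (2 * N) // i < β.partner i}, x.val ≠ b := by
    rintro ⟨x, hx⟩ rfl
    exact hb.asymm hx
  have hright : ∀ y : {i : Fin (2 * N) // i < β.partner i}, β.partner y.val ≠ a := by
    rintro ⟨y, hy⟩ rfl
    rw [hp] at ha
    exact ha.asymm hy
  have hk : ∀ y : {i : Fin (2 * N) // i < β.partner i}, β.partner y.val = b ↔ y = k := by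
    intro y
    rw [β.partner_eq_iff, Subtype.ext_iff]
  have hi : ∀ x : {i : Fin (2 * N) // i < β.partner i}, x.val = a ↔ x = i := by
    intro x
    rw [Subtype.ext_iff]
  have key : ∀ 𝔏 : Fin (2 * N) → Fin (2 * N) → ℂ,
      fominDet (setLink 𝔏 a b z) β = fominDet (setLink 𝔏 a b 0) β +
        z * (Matrix.of fun a' b' : {i : Fin (2 * N) // i < β.partner i} =>
          setLink 𝔏 a b 0 a'.val (β.partner b'.val)).adjugate k i := by
    intro 𝔏
    rw [fominDet, fominDet, ← det_updateRow_add_single]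
    congr 1
    ext x y
    simp only [Matrix.of_apply, Matrix.updateRow_apply, setLink, hi, hk, hleft, hright,
      false_and, or_false, Pi.add_apply, Pi.smul_apply, Pi.single_apply, smul_eq_mul]
    by_cases hx : x = i <;> by_cases hy : y = k <;> simp [hx, hy, i]
  rw [key 𝔎, key 𝔎', add_sub_cancel_left, add_sub_cancel_left]
  congr 1
  refine adjugate_congr fun x y hx hy => ?_
  have hx' := (hi x).not.2 hx
  have hy' := (hk y).not.2 hy
  simp only [Matrix.of_apply, setLink, hx', hy', hleft, hright, false_and, or_false, if_false]
  exact h _ _ hx' (hright y) (hleft x) hy'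

theorem fominDet_setLink_of_not (𝔎 : Fin (2 * N) → Fin (2 * N) → ℂ) {a b : Fin (2 * N)}
    (z : ℂ) {β : LinkPattern N}
    (h : ¬ (a < β.partner a ∧ β.partner b < b)) (h' : ¬ (b < β.partner b ∧ β.partner a < a)) :
    fominDet (setLink 𝔎 a b z) β = fominDet 𝔎 β := by
  have hp := β.partner_partner
  rw [fominDet, fominDet]
  congr 1
  ext x y
  have hx := x.2
  have hy := y.2
  simp only [Matrix.of_apply, setLink]
  refine if_neg ?_
  rintro (⟨h1, h2⟩ | ⟨h1, h2⟩)
  · refine h ⟨by rwa [h1] at hx, ?_⟩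
    rw [← h2, hp]
    exact hy
  · refine h' ⟨by rwa [h1] at hx, ?_⟩
    rw [← h2, hp]
    exact hy

/-- The dependence of a determinant on one entry of the kernel does not involve the other entries
in the same row and column. -/
theorem fominDet_setLink_sub (𝔎 𝔎' : Fin (2 * N) → Fin (2 * N) → ℂ) {a b : Fin (2 * N)}
    (h : ∀ x y, x ≠ a → y ≠ a → x ≠ b → y ≠ b → 𝔎 x y = 𝔎' x y) (z : ℂ) (β : LinkPattern N) :
    fominDet (setLink 𝔎 a b z) β - fominDet (setLink 𝔎 a b 0) β =
      fominDet (setLink 𝔎' a b z) β - fominDet (setLink 𝔎' a b 0) β := by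
  by_cases h1 : a < β.partner a ∧ β.partner b < b
  · exact fominDet_setLink_of_left_right 𝔎 𝔎' h z h1.1 h1.2
  · by_cases h2 : b < β.partner b ∧ β.partner a < a
    · simp only [setLink_comm _ a b]
      exact fominDet_setLink_of_left_right 𝔎 𝔎' (fun x y h3 h4 h5 h6 => h x y h5 h6 h3 h4) z
        h2.1 h2.2
    · simp only [fominDet_setLink_of_not _ _ h1 h2, sub_self]

/-- A sum that is antisymmetric under the exchange of `a` and `b` does not depend on the entry of
the kernel at `{a, b}`. -/
theorem inverseFominSum_setLink {α : LinkPattern N} {a b : Fin (2 * N)}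
    (hanti : ∀ 𝔎 : Fin (2 * N) → Fin (2 * N) → ℂ,
      inverseFominSum (fun x y => 𝔎 (Equiv.swap a b x) (Equiv.swap a b y)) α =
        - inverseFominSum 𝔎 α) (𝔎 : Fin (2 * N) → Fin (2 * N) → ℂ) (z : ℂ) :
    inverseFominSum (setLink 𝔎 a b z) α = inverseFominSum (setLink 𝔎 a b 0) α := by
  set 𝔎' := fun x y => 𝔎 (Equiv.swap a b x) (Equiv.swap a b y) with h𝔎'
  -- The exchanged kernel agrees with the original one away from `a` and `b`, so the increments
  -- agree. By antisymmetry they are also opposite, hence zero.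
  have h1 : inverseFominSum (setLink 𝔎 a b z) α - inverseFominSum (setLink 𝔎 a b 0) α =
      inverseFominSum (setLink 𝔎' a b z) α - inverseFominSum (setLink 𝔎' a b 0) α := by
    simp only [inverseFominSum, ← Finset.sum_sub_distrib, ← mul_sub]
    refine Finset.sum_congr rfl fun β _ => ?_
    rw [fominDet_setLink_sub 𝔎 𝔎' _ z β]
    intro x y h1 h2 h3 h4
    rw [h𝔎']
    simp only [Equiv.swap_apply_of_ne_of_ne h1 h3, Equiv.swap_apply_of_ne_of_ne h2 h4]
  have h2 : ∀ w, inverseFominSum (setLink 𝔎' a b w) α =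
      - inverseFominSum (setLink 𝔎 a b w) α := by
    intro w
    rw [← hanti]
    congr 1
    funext x y
    simp only [setLink, h𝔎', Equiv.swap_apply_def]
    split_ifs <;> grind
  rw [h2, h2] at h1
  have h3 : (2 : ℂ) * (inverseFominSum (setLink 𝔎 a b z) α -
      inverseFominSum (setLink 𝔎 a b 0) α) = 0 := by linear_combination h1
  simpa [sub_eq_zero] using h3

/-- With `c` the index before `b`, one has `(a b) = (c b)(a c)(c b)`, and each of the three factors
contributes a sign. -/
theorem inverseFominSum_swap_of_lt {α : LinkPattern N} (n : ℕ) :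
    ∀ {a b : Fin (2 * N)}, b.val = a.val + (n + 1) →
    (∀ c d : Fin (2 * N), a ≤ c → d ≤ b → d.val = c.val + 1 → α.partner c ≠ d) →
    ∀ 𝔎 : Fin (2 * N) → Fin (2 * N) → ℂ,
    inverseFominSum (fun x y => 𝔎 (Equiv.swap a b x) (Equiv.swap a b y)) α =
      - inverseFominSum 𝔎 α := by
  induction n with
  | zero =>
    intro a b hab h 𝔎
    exact inverseFominSum_swap 𝔎 hab (h a b le_rfl le_rfl hab)
  | succ n ih =>
    intro a b hab h 𝔎
    have hb := b.isLt
    obtain ⟨c, hc⟩ : ∃ c : Fin (2 * N), c.val = a.val + (n + 1) := ⟨⟨a.val + (n + 1), by omega⟩, rfl⟩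
    have hcb : α.partner c ≠ b :=
      h c b (by rw [Fin.le_def]; omega) le_rfl (by omega)
    have hs : ∀ x, Equiv.swap a b x =
        Equiv.swap c b (Equiv.swap a c (Equiv.swap c b x)) := by
      intro x
      have h1 : a ≠ c := by rintro rfl; omega
      have h2 : c ≠ b := by rintro rfl; omega
      have h3 : a ≠ b := by rintro rfl; omega
      simp only [Equiv.swap_apply_def]
      grind
    simp only [hs]
    rw [inverseFominSum_swap
        (fun x y => 𝔎 (Equiv.swap c b (Equiv.swap a c x)) (Equiv.swap c b (Equiv.swap a c y)))
        (by omega) hcb,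
      ih hc (fun e d h1 h2 => h e d h1 (h2.trans (by rw [Fin.le_def]; omega)))
        (fun x y => 𝔎 (Equiv.swap c b x) (Equiv.swap c b y)),
      inverseFominSum_swap 𝔎 (by omega) hcb, neg_neg]

/-! ### Positions inside a block -/

namespace Valences

variable {d n : ℕ} (ς : Valences d n) (j : Fin d)

theorem mem_block {k : Fin n} :
    k ∈ ς.block j ↔ ς.start j ≤ k.val ∧ k.val < ς.start j + ς.s j := by
  simp [block]

theorem point_mem_block (m : Fin (ς.s j)) : ς.point j m ∈ ς.block j := by
  rw [mem_block]
  have := m.isLt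
  simp only [point]
  omega

/-- The position of an index in its block. -/
def position (k : Fin n) (hk : k ∈ ς.block j) : Fin (ς.s j) :=
  ⟨k.val - ς.start j, by have := (ς.mem_block j).1 hk; omega⟩

@[simp]
theorem point_position (k : Fin n) (hk : k ∈ ς.block j) : ς.point j (ς.position j k hk) = k := by
  have := (ς.mem_block j).1 hk
  ext
  simp only [point, position]
  omega

@[simp]
theorem position_point (m : Fin (ς.s j)) :
    ς.position j (ς.point j m) (ς.point_mem_block j m) = m := by
  ext
  simp [point, position]

theorem point_injective : Function.Injective (ς.point j) := by
  intro m m' h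
  have := congrArg Fin.val h
  simp only [point] at this
  ext
  omega

end Valences

/-! ### The sum as an alternating function of the rows of a block -/

section Block

variable {d : ℕ} (ς : Valences d (2 * N)) (j : Fin d) {α : LinkPattern N}

theorem inverseFominSum_swap_block (hα : ∀ a ∈ ς.block j, α.partner a ∉ ς.block j)
    {a b : Fin (2 * N)} (ha : a ∈ ς.block j) (hb : b ∈ ς.block j) (hne : a ≠ b)
    (𝔎 : Fin (2 * N) → Fin (2 * N) → ℂ) :
    inverseFominSum (fun x y => 𝔎 (Equiv.swap a b x) (Equiv.swap a b y)) α =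
      - inverseFominSum 𝔎 α := by
  wlog hlt : a < b generalizing a b
  · rw [Equiv.swap_comm]
    exact this hb ha hne.symm (lt_of_le_of_ne (not_lt.1 hlt) hne.symm)
  rw [Fin.lt_def] at hlt
  refine inverseFominSum_swap_of_lt (b.val - a.val - 1) (by omega) ?_ 𝔎
  intro c e h1 h2 h3 h4
  rw [Fin.le_def] at h1 h2
  have ha' := (ς.mem_block j).1 ha
  have hb' := (ς.mem_block j).1 hb
  refine hα c ((ς.mem_block j).2 ⟨by omega, by omega⟩) ?_
  rw [h4]
  exact (ς.mem_block j).2 ⟨by omega, by omega⟩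

/-- The inverse Fomin type sum of a pattern without links inside a block does not depend on the
entries of the kernel inside the block. -/
theorem inverseFominSum_erase_block (hα : ∀ a ∈ ς.block j, α.partner a ∉ ς.block j)
    (𝔎 : Fin (2 * N) → Fin (2 * N) → ℂ) (hsymm : ∀ a b, 𝔎 a b = 𝔎 b a)
    (hdiag : ∀ a, 𝔎 a a = 0) :
    inverseFominSum 𝔎 α =
      inverseFominSum (fun a b => if a ∈ ς.block j ∧ b ∈ ς.block j then 0 else 𝔎 a b) α := by
  -- The entries are erased one pair at a time.
  have key : ∀ P : Finset (Fin (2 * N) × Fin (2 * N)),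
      (∀ c ∈ P, c.1 ∈ ς.block j ∧ c.2 ∈ ς.block j ∧ c.1 ≠ c.2) →
      inverseFominSum 𝔎 α =
        inverseFominSum (fun a b => if (a, b) ∈ P ∨ (b, a) ∈ P then 0 else 𝔎 a b) α := by
    intro P
    induction P using Finset.induction_on with
    | empty => simp
    | insert c P hc ih =>
      intro hP
      rw [ih fun c' hc' => hP c' (Finset.mem_insert_of_mem hc')]
      obtain ⟨a, b⟩ := c
      obtain ⟨ha, hb, hne⟩ := hP (a, b) (Finset.mem_insert_self _ _)
      have hz := fun z => inverseFominSum_setLink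
        (inverseFominSum_swap_block ς j hα ha hb hne)
        (fun a b => if (a, b) ∈ P ∨ (b, a) ∈ P then 0 else 𝔎 a b) z
      -- Setting the entry to its present value changes nothing, and this value may then be replaced
      -- by `0`.
      refine Eq.trans ?_ ((hz (if (a, b) ∈ P ∨ (b, a) ∈ P then 0 else 𝔎 a b)).trans ?_)
      · congr 1
        funext x y
        rw [setLink]
        split_ifs with h1 h2 h3 <;> try rfl
        all_goals grind
      · congr 1
        funext x y
        simp only [setLink, Finset.mem_insert, Prod.mk.injEq]
        grind
  rw [key ((ς.block j ×ˢ ς.block j).filter fun c => c.1 ≠ c.2)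
    (fun c hc => by
      simp only [Finset.mem_filter, Finset.mem_product] at hc
      exact ⟨hc.1.1, hc.1.2, hc.2⟩)]
  congr 1
  funext x y
  simp only [Finset.mem_filter, Finset.mem_product]
  by_cases hxy : x = y
  · subst hxy
    simp [hdiag]
  · simp [hxy, Ne.symm hxy, and_comm]

/-- The symmetric kernel with given rows at the indices of a block, with entries `0` inside the
block and with the entries of `G` outside. -/
def blockKernel (G : Fin (2 * N) → Fin (2 * N) → ℂ) (v : Fin (ς.s j) → Fin (2 * N) → ℂ)
    (a b : Fin (2 * N)) : ℂ :=
  if ha : a ∈ ς.block j then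
    if b ∈ ς.block j then 0 else v (ς.position j a ha) b
  else
    if hb : b ∈ ς.block j then v (ς.position j b hb) a else G a b

variable (G : Fin (2 * N) → Fin (2 * N) → ℂ)

theorem blockKernel_update_of_ne (v : Fin (ς.s j) → Fin (2 * N) → ℂ) (m : Fin (ς.s j))
    (u u' : Fin (2 * N) → ℂ) {a b : Fin (2 * N)} (ha : a ≠ ς.point j m) (hb : b ≠ ς.point j m) :
    blockKernel ς j G (Function.update v m u) a b =
      blockKernel ς j G (Function.update v m u') a b := by
  have h : ∀ (k : Fin (2 * N)) (hk : k ∈ ς.block j), k ≠ ς.point j m → ς.position j k hk ≠ m := by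
    rintro k hk hne rfl
    exact hne (ς.point_position j k hk).symm
  unfold blockKernel
  split_ifs with h1 h2 h3
  · rfl
  · rw [Function.update_of_ne (h a h1 ha), Function.update_of_ne (h a h1 ha)]
  · rw [Function.update_of_ne (h b h3 hb), Function.update_of_ne (h b h3 hb)]
  · rfl

theorem blockKernel_point_left (v : Fin (ς.s j) → Fin (2 * N) → ℂ) (m : Fin (ς.s j))
    (b : Fin (2 * N)) :
    blockKernel ς j G v (ς.point j m) b = if b ∈ ς.block j then 0 else v m b := by
  simp [blockKernel, ς.point_mem_block j m]

theorem blockKernel_point_right (v : Fin (ς.s j) → Fin (2 * N) → ℂ) (m : Fin (ς.s j))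
    (a : Fin (2 * N)) :
    blockKernel ς j G v a (ς.point j m) = if a ∈ ς.block j then 0 else v m a := by
  simp [blockKernel, ς.point_mem_block j m]

/-- An index is either a left or a right endpoint of `β`, so `v m` enters exactly one row or exactly
one column of the matrix. -/
theorem fominDet_blockKernel_linear (v : Fin (ς.s j) → Fin (2 * N) → ℂ) (m : Fin (ς.s j))
    (β : LinkPattern N) :
    ∃ ℓ : (Fin (2 * N) → ℂ) →ₗ[ℂ] ℂ,
      ∀ u, fominDet (blockKernel ς j G (Function.update v m u)) β = ℓ u := by
  have hp := β.partner_partner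
  let L : (Fin (2 * N) → ℂ) →ₗ[ℂ] (Fin (2 * N) → ℂ) :=
    { toFun := fun u b => if b ∈ ς.block j then 0 else u b
      map_add' := fun u w => by ext b; simp only [Pi.add_apply]; split_ifs <;> simp
      map_smul' := fun c u => by ext b; simp }
  let M : Matrix {i : Fin (2 * N) // i < β.partner i} {i : Fin (2 * N) // i < β.partner i} ℂ :=
    Matrix.of fun a b => blockKernel ς j G (Function.update v m 0) a.val (β.partner b.val)
  rcases β.lt_or_gt (ς.point j m) with h | h
  · let i : {i : Fin (2 * N) // i < β.partner i} := ⟨ς.point j m, h⟩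
    refine ⟨((Matrix.detRowAlternating (R := ℂ)
      (n := {i : Fin (2 * N) // i < β.partner i})).toMultilinearMap.toLinearMap M i) ∘ₗ
        (LinearMap.funLeft ℂ ℂ (fun y : {i : Fin (2 * N) // i < β.partner i} =>
          β.partner y.val)) ∘ₗ L, fun u => ?_⟩
    change _ = (M.updateRow i _).det
    rw [fominDet]
    congr 1
    ext x y
    by_cases hx : x = i
    · subst hx
      simp [i, blockKernel_point_left, L, LinearMap.funLeft]
    · rw [Matrix.updateRow_ne hx]
      refine blockKernel_update_of_ne ς j G v m u 0 (fun h' => hx (Subtype.ext h')) fun h' => ?_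
      rw [← h', hp] at h
      exact h.asymm y.2
  · let i : {i : Fin (2 * N) // i < β.partner i} := ⟨β.partner (ς.point j m), by rwa [hp]⟩
    refine ⟨((Matrix.detRowAlternating (R := ℂ)
      (n := {i : Fin (2 * N) // i < β.partner i})).toMultilinearMap.toLinearMap M.transpose i) ∘ₗ
        (LinearMap.funLeft ℂ ℂ (fun y : {i : Fin (2 * N) // i < β.partner i} =>
          y.val)) ∘ₗ L, fun u => ?_⟩
    change _ = (M.transpose.updateRow i _).det
    rw [fominDet, ← Matrix.det_transpose]
    congr 1
    ext x y
    by_cases hx : x = i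
    · subst hx
      simp [i, hp, blockKernel_point_right, L, LinearMap.funLeft]
    · rw [Matrix.updateRow_ne hx]
      refine blockKernel_update_of_ne ς j G v m u 0 (fun h' => ?_) fun h' => ?_
      · rw [← h'] at h
        exact h.asymm y.2
      · exact hx (Subtype.ext ((β.partner_eq_iff).1 h'))

theorem inverseFominSum_blockKernel_linear (v : Fin (ς.s j) → Fin (2 * N) → ℂ)
    (m : Fin (ς.s j)) (α : LinkPattern N) :
    ∃ ℓ : (Fin (2 * N) → ℂ) →ₗ[ℂ] ℂ,
      ∀ u, inverseFominSum (blockKernel ς j G (Function.update v m u)) α = ℓ u := by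
  classical
  choose ℓ hℓ using fominDet_blockKernel_linear ς j G v m
  refine ⟨∑ β with α.Below β, (tilingCount α β : ℂ) • ℓ β, fun u => ?_⟩
  simp [inverseFominSum, hℓ]

/-- Two equal rows make the kernel invariant under the exchange, as the entries inside the block
vanish. With antisymmetry this makes the sum vanish. -/
theorem blockKernel_swap (v : Fin (ς.s j) → Fin (2 * N) → ℂ) {m m' : Fin (ς.s j)}
    (h : v m = v m') (a b : Fin (2 * N)) :
    blockKernel ς j G v (Equiv.swap (ς.point j m) (ς.point j m') a)
      (Equiv.swap (ς.point j m) (ς.point j m') b) = blockKernel ς j G v a b := by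
  have h1 : ∀ k, Equiv.swap (ς.point j m) (ς.point j m') k ∈ ς.block j ↔ k ∈ ς.block j := by
    intro k
    rw [Equiv.swap_apply_def]
    split_ifs with h1 h2
    · simp [h1, ς.point_mem_block]
    · simp [h2, ς.point_mem_block]
    · rfl
  have h2 : ∀ k, k ∉ ς.block j → Equiv.swap (ς.point j m) (ς.point j m') k = k := by
    intro k hk
    refine Equiv.swap_apply_of_ne_of_ne ?_ ?_
    · rintro rfl; exact hk (ς.point_mem_block j m)
    · rintro rfl; exact hk (ς.point_mem_block j m')
  have h3 : ∀ k hk hk', v (ς.position j (Equiv.swap (ς.point j m) (ς.point j m') k) hk') =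
      v (ς.position j k hk) := by
    intro k hk hk'
    obtain ⟨i, rfl⟩ : ∃ i, ς.point j i = k := ⟨_, ς.point_position j k hk⟩
    have : ς.position j (Equiv.swap (ς.point j m) (ς.point j m') (ς.point j i)) hk' =
        Equiv.swap m m' i := by
      apply ς.point_injective j
      rw [ς.point_position]
      exact ((ς.point_injective j).swap_apply m m' i)
    rw [this, ς.position_point, Equiv.swap_apply_def]
    split_ifs with e1 e2
    · rw [e1, h]
    · rw [e2, h]
    · rfl
  by_cases ha : a ∈ ς.block j <;> by_cases hb : b ∈ ς.block j
  · simp [blockKernel, h1, ha, hb]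
  · simp only [blockKernel, h1, ha, hb, dif_pos, if_false, h2 b hb]
    rw [h3 a ha]
  · simp only [blockKernel, h1, ha, hb, dif_pos, dif_neg, h2 a ha, not_false_iff]
    rw [h3 b hb]
  · simp [blockKernel, ha, hb, h2]

/-- The inverse Fomin type sum as an alternating map of the rows of a block. -/
noncomputable def blockAlternating (hα : ∀ a ∈ ς.block j, α.partner a ∉ ς.block j) :
    (Fin (2 * N) → ℂ) [⋀^Fin (ς.s j)]→ₗ[ℂ] ℂ where
  toFun v := inverseFominSum (blockKernel ς j G v) α
  map_update_add' := by
    intro inst v m u w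
    rw [Subsingleton.elim inst (instDecidableEqFin _)]
    obtain ⟨ℓ, hℓ⟩ := inverseFominSum_blockKernel_linear ς j G v m α
    simp only [hℓ, map_add]
  map_update_smul' := by
    intro inst v m c u
    rw [Subsingleton.elim inst (instDecidableEqFin _)]
    obtain ⟨ℓ, hℓ⟩ := inverseFominSum_blockKernel_linear ς j G v m α
    simp only [hℓ, map_smul]
  map_eq_zero_of_eq' := by
    intro v m m' h hne
    have h1 := inverseFominSum_swap_block ς j hα (ς.point_mem_block j m)
      (ς.point_mem_block j m') (fun h => hne (ς.point_injective j h)) (blockKernel ς j G v)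
    simp only [blockKernel_swap ς j G v h] at h1
    exact self_eq_neg.1 h1

end Block

/-- A linear change of the arguments multiplies an alternating map by the determinant. -/
theorem alternatingMap_sum_matrix_smul {ι R M : Type*} [Fintype ι] [DecidableEq ι] [CommRing R]
    [AddCommGroup M] [Module R M] (f : M [⋀^ι]→ₗ[R] R) (P : Matrix ι ι R) (w : ι → M) :
    (f fun i => ∑ k, P i k • w k) = P.det * f w := by
  let L : (ι → R) →ₗ[R] M := Fintype.linearCombination R w
  have h := (f.compLinearMap L).eq_smul_basis_det (Pi.basisFun R ι)
  have h1 : f (fun i => L (P i)) = f (fun i => L (Pi.basisFun R ι i)) * P.det :=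
    (congrArg (fun g : (ι → R) [⋀^ι]→ₗ[R] R => g fun i => P i) h).trans
      (congrArg (f (fun i => L (Pi.basisFun R ι i)) * ·) (Pi.basisFun_det_apply P))
  have h2 : (fun i => L (Pi.basisFun R ι i)) = w := by
    funext i
    simp [L]
  have h3 : (fun i => L (P i)) = fun i => ∑ k, P i k • w k := by
    funext i
    simp [L, Fintype.linearCombination_apply]
  rw [h2, h3] at h1
  rw [h1, mul_comm]

end

/-! ### Newton interpolation -/

theorem _root_.Polynomial.iteratedDeriv_eval (p : Polynomial ℝ) (n : ℕ) :
    iteratedDeriv n (fun t => p.eval t) = fun t => (Polynomial.derivative^[n] p).eval t := by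
  induction n with
  | zero => simp
  | succ n ih =>
    rw [iteratedDeriv_succ, ih]
    funext t
    rw [Polynomial.deriv, Function.iterate_succ_apply']

theorem _root_.ContDiffAt.deriv_infty {g : ℝ → ℝ} {t : ℝ} (h : ContDiffAt ℝ (⊤ : ℕ∞) g t) :
    ContDiffAt ℝ (⊤ : ℕ∞) (deriv g) t := by
  have := h.derivWithin (m := (⊤ : ℕ∞)) (by norm_cast)
  exact this

/-- Rolle's theorem, iterated: `n + 1` zeros of `g` give `n` zeros of `deriv g`. Values `x i` with
`i > n` are irrelevant. -/
theorem exists_iteratedDeriv_eq_zero {A B : ℝ} (n : ℕ) :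
    ∀ (g : ℝ → ℝ) (x : ℕ → ℝ), (∀ t ∈ Set.Icc A B, ContDiffAt ℝ (⊤ : ℕ∞) g t) →
      (∀ i < n, x i < x (i + 1)) → (∀ i ≤ n, x i ∈ Set.Icc A B) → (∀ i ≤ n, g (x i) = 0) →
      ∃ θ ∈ Set.Icc A B, iteratedDeriv n g θ = 0 := by
  induction n with
  | zero => exact fun g x _ _ h1 h2 => ⟨x 0, h1 0 le_rfl, by simpa using h2 0 le_rfl⟩
  | succ n ih =>
    intro g x hg hx hAB h0
    have hy : ∀ i, ∃ y, i ≤ n → y ∈ Set.Ioo (x i) (x (i + 1)) ∧ deriv g y = 0 := by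
      intro i
      by_cases hi : i ≤ n
      · obtain ⟨y, hy, hd⟩ := exists_deriv_eq_zero (f := g) (hx i (by omega))
          (fun t ht => (hg t ⟨(hAB i (by omega)).1.trans ht.1,
            ht.2.trans (hAB (i + 1) (by omega)).2⟩).continuousAt.continuousWithinAt)
          (by rw [h0 i (by omega), h0 (i + 1) (by omega)])
        exact ⟨y, fun _ => ⟨hy, hd⟩⟩
      · exact ⟨0, fun h => absurd h hi⟩
    choose y hy using hy
    obtain ⟨θ, hθ, h⟩ := ih (deriv g) y (fun t ht => (hg t ht).deriv_infty)
      (fun i hi => (hy i (by omega)).1.2.trans (hy (i + 1) (by omega)).1.1)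
      (fun i hi => ⟨(hAB i (by omega)).1.trans (hy i hi).1.1.le,
        (hy i hi).1.2.le.trans (hAB (i + 1) (by omega)).2⟩)
      (fun i hi => (hy i hi).2)
    exact ⟨θ, hθ, by rwa [iteratedDeriv_succ']⟩

/-- The matrix of values of the Newton basis polynomials at the nodes. -/
def newtonMatrix {s : ℕ} {R : Type*} [CommRing R] (z : Fin s → R) : Matrix (Fin s) (Fin s) R :=
  Matrix.of fun i m => ∏ k ∈ Finset.Iio m, (z i - z k)

theorem det_newtonMatrix {s : ℕ} {R : Type*} [CommRing R] (z : Fin s → R) :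
    (newtonMatrix z).det = ∏ m, ∏ k ∈ Finset.Iio m, (z m - z k) := by
  rw [Matrix.det_of_isLowerTriangular]
  · rfl
  · intro i m him
    exact Finset.prod_eq_zero (i := i) (Finset.mem_Iio.2 (by simpa using him)) (sub_self _)

open Polynomial in
/-- Newton interpolation with the mean value form of divided differences. -/
theorem exists_newton_mean_value {s : ℕ} {z : Fin s → ℝ} (hz : StrictMono z) {A B : ℝ}
    (hAB : ∀ i, z i ∈ Set.Icc A B) {g : ℝ → ℝ}
    (hg : ∀ t ∈ Set.Icc A B, ContDiffAt ℝ (⊤ : ℕ∞) g t) :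
    ∃ θ : Fin s → ℝ, (∀ m, θ m ∈ Set.Icc A B) ∧
      ∀ i, g (z i) = ∑ m, newtonMatrix z i m *
        (iteratedDeriv m.val g (θ m) / (m.val.factorial : ℝ)) := by
  have hdet : IsUnit (newtonMatrix z).det := by
    rw [isUnit_iff_ne_zero, det_newtonMatrix, Finset.prod_ne_zero_iff]
    intro m _
    rw [Finset.prod_ne_zero_iff]
    intro k hk
    exact sub_ne_zero.2 (hz (Finset.mem_Iio.1 hk)).ne'
  set c := (newtonMatrix z)⁻¹.mulVec (fun i => g (z i)) with hc
  -- The coefficients `c` are the divided differences of `g`, obtained by inverting the triangular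
  -- system.
  have hv : ∀ i, g (z i) = ∑ m, newtonMatrix z i m * c m := by
    have : (newtonMatrix z).mulVec c = fun i => g (z i) := by
      rw [hc, Matrix.mulVec_mulVec, Matrix.mul_nonsing_inv _ hdet, Matrix.one_mulVec]
    intro i
    exact (congrFun this i).symm
  have key : ∀ m : Fin s, ∃ θ ∈ Set.Icc A B,
      c m = iteratedDeriv m.val g θ / (m.val.factorial : ℝ) := by
    intro m
    -- The interpolant at the first `m + 1` nodes has degree at most `m` and coefficient `c m` at `X
    -- ^ m`, so its `m`-th derivative is `m! * c m`. The difference `g - p` vanishes at these nodes,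
    -- so its `m`-th derivative vanishes somewhere.
    let p : ℝ[X] := ∑ k ∈ Finset.Iic m, C (c k) * ∏ l ∈ Finset.Iio k, (X - C (z l))
    have hdeg : ∀ k : Fin s, (∏ l ∈ Finset.Iio k, (X - C (z l))).natDegree = k.val := by
      intro k
      rw [natDegree_prod_of_monic _ _ fun l _ => monic_X_sub_C _]
      simp
    have hmon : ∀ k : Fin s, (∏ l ∈ Finset.Iio k, (X - C (z l))).Monic :=
      fun k => monic_prod_of_monic _ _ fun l _ => monic_X_sub_C _
    have hp : ∀ i ≤ m, p.eval (z i) = g (z i) := by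
      intro i hi
      rw [hv i]
      simp only [p, eval_finsetSum, eval_mul, eval_C, eval_prod, eval_sub, eval_X]
      rw [← Finset.sum_subset (Finset.subset_univ (Finset.Iic m))]
      · exact Finset.sum_congr rfl fun k _ => mul_comm _ _
      · intro k _ hk
        have : i < k := lt_of_le_of_lt hi (by simpa using hk)
        rw [newtonMatrix, Matrix.of_apply,
          Finset.prod_eq_zero (i := i) (Finset.mem_Iio.2 this) (sub_self _), zero_mul]
    have hcoeff : ∀ r, m.val ≤ r → p.coeff r = if r = m.val then c m else 0 := by
      intro r hr
      simp only [p, finsetSum_coeff, coeff_C_mul]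
      have h0 : ∀ k ∈ Finset.Iic m, k ≠ m →
          c k * (∏ l ∈ Finset.Iio k, (X - C (z l))).coeff r = 0 := by
        intro k hk hne
        have hkm : k < m := lt_of_le_of_ne (Finset.mem_Iic.1 hk) hne
        rw [coeff_eq_zero_of_natDegree_lt, mul_zero]
        rw [hdeg]
        have := Fin.lt_def.1 hkm
        omega
      rw [Finset.sum_eq_single_of_mem m (Finset.mem_Iic.2 le_rfl) h0]
      split_ifs with h
      · have := (hmon m).coeff_natDegree
        rw [hdeg] at this
        rw [h, this, mul_one]
      · rw [coeff_eq_zero_of_natDegree_lt, mul_zero]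
        rw [hdeg]
        omega
    have hder : derivative^[m.val] p = C ((m.val.factorial : ℝ) * c m) := by
      ext r
      rw [coeff_iterate_derivative, hcoeff _ (by omega), coeff_C]
      by_cases hr : r = 0
      · subst hr
        simp [Nat.descFactorial_self]
      · rw [if_neg (by omega), if_neg hr, smul_zero]
    have hcont : ∀ t, ContDiffAt ℝ (⊤ : ℕ∞) (fun t => p.eval t) t := fun t => by
      simpa using! (p.contDiff_aeval (⊤ : ℕ∞)).contDiffAt (x := t)
    obtain ⟨θ, hθ, h⟩ := exists_iteratedDeriv_eq_zero (A := A) (B := B) m.val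
      (g - fun t => p.eval t) (fun i => if h : i < s then z ⟨i, h⟩ else 0)
      (fun t ht => (hg t ht).sub (hcont t))
      (fun i hi => by
        have := m.isLt
        rw [dif_pos (by omega), dif_pos (by omega)]
        exact hz (by simp [Fin.lt_def]))
      (fun i hi => by
        have := m.isLt
        rw [dif_pos (by omega)]
        exact hAB _)
      (fun i hi => by
        have := m.isLt
        rw [dif_pos (by omega), Pi.sub_apply, hp _ (by rw [Fin.le_def]; exact hi), sub_self])
    refine ⟨θ, hθ, ?_⟩
    rw [iteratedDeriv_sub ((hg θ hθ).of_le (by exact_mod_cast le_top))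
      ((hcont θ).of_le (by exact_mod_cast le_top)), Polynomial.iteratedDeriv_eval, hder] at h
    simp only [eval_C] at h
    rw [eq_div_iff (by exact_mod_cast m.val.factorial_ne_zero)]
    linarith
  choose θ hθ hcθ using key
  exact ⟨θ, hθ, fun i => by rw [hv i]; simp only [hcθ]⟩

/-! ### Fusion of indices and the normalizing factor as a Vandermonde product -/

namespace Valences

variable {d n : ℕ} (ς : Valences d n) (j : Fin d)

theorem first_mem_block : ς.first j ∈ ς.block j := ς.point_mem_block j _

theorem keep_fuse {b : Fin n} (hb : b ∉ ς.block j) : ς.keep j (ς.fuse j b) = b := by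
  rw [mem_block] at hb
  have := ς.pos j
  ext
  simp only [keep, fuse]
  split_ifs <;> omega

theorem keep_fuse_first : ς.keep j (ς.fuse j (ς.first j)) = ς.first j := by
  have := ς.pos j
  ext
  simp [keep, fuse, first, point, this]

theorem fuse_lt_fuse {a b : Fin n} (h : a < b) (hab : a ∉ ς.block j ∨ b ∉ ς.block j) :
    ς.fuse j a < ς.fuse j b := by
  rw [mem_block, mem_block] at hab
  rw [Fin.lt_def] at *
  have := ς.pos j
  simp only [fuse]
  split_ifs <;> omega

/-- Both sides are the product of all differences of two points of the block; the pairs that contain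
the first point give the factors `δ_p`. -/
theorem fusionFactor_eq (x : Fin n → ℝ) :
    ς.fusionFactor j x = (newtonMatrix fun m => x (ς.point j m)).det := by
  have hpos := ς.pos j
  let h : Fin (ς.s j) → ℝ := fun q => ∏ r, if q < r then x (ς.point j r) - x (ς.point j q) else 1
  have h1 : (newtonMatrix fun m => x (ς.point j m)).det = ∏ q, h q := by
    rw [det_newtonMatrix, Finset.prod_comm]
    refine Finset.prod_congr rfl fun m _ => ?_
    rw [← Finset.prod_filter]
    congr 1
    ext k
    simp
  have h2 : ∏ qr : Fin (ς.s j) × Fin (ς.s j) with 0 < qr.1.val ∧ qr.1 < qr.2,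
      (ς.gap j x qr.2 - ς.gap j x qr.1) = ∏ q ∈ Finset.univ.erase ⟨0, hpos⟩, h q := by
    rw [Finset.prod_filter, Fintype.prod_prod_type, ← Finset.mul_prod_erase _ _
      (Finset.mem_univ (⟨0, hpos⟩ : Fin (ς.s j)))]
    rw [Finset.prod_eq_one (fun r _ => by simp), one_mul]
    refine Finset.prod_congr rfl fun q hq => Finset.prod_congr rfl fun r _ => ?_
    have hq' : 0 < q.val := by
      rw [Finset.mem_erase, ne_eq, Fin.ext_iff] at hq
      exact Nat.pos_of_ne_zero hq.1
    simp only [hq', true_and, gap, sub_sub_sub_cancel_right]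
  have h3 : ∏ p : Fin (ς.s j) with 0 < p.val, ς.gap j x p = h ⟨0, hpos⟩ := by
    rw [Finset.prod_filter]
    rfl
  rw [fusionFactor, h1, h2, h3, Finset.mul_prod_erase _ _ (Finset.mem_univ _)]

theorem fusionFactor_ne_zero {x : Fin n → ℝ} (hx : x ∈ chamber n) : ς.fusionFactor j x ≠ 0 := by
  rw [fusionFactor_eq, det_newtonMatrix, Finset.prod_ne_zero_iff]
  intro m _
  rw [Finset.prod_ne_zero_iff]
  intro k hk
  refine sub_ne_zero.2 (ne_of_gt (hx ?_))
  have := Fin.lt_def.1 (Finset.mem_Iio.1 hk)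
  simp only [point, Fin.lt_def]
  omega

end Valences

/-! ### Derivatives of the power entries -/

theorem contDiffAt_abs_rpow (q : ℝ) {t : ℝ} (ht : t ≠ 0) :
    ContDiffAt ℝ (⊤ : ℕ∞) (fun t : ℝ => |t| ^ q) t :=
  (contDiffAt_abs ht).rpow_const_of_ne (abs_ne_zero.2 ht)

theorem continuousAt_iteratedDeriv {g : ℝ → ℝ} {t : ℝ} (m : ℕ)
    (hg : ContDiffAt ℝ (⊤ : ℕ∞) g t) : ContinuousAt (iteratedDeriv m g) t := by
  have h := hg.continuousAt_iteratedFDeriv (k := m) (by exact_mod_cast le_top)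
  exact h.eval_const (fun _ : Fin m => (1 : ℝ))

section PowerEntry

variable {n : ℕ} (C : Fin n → ℂ) (p : Fin n → ℝ) (b : Fin n)

theorem contDiffAt_abs_sub_rpow (q : ℝ) {u t : ℝ} (h : u ≠ t) :
    ContDiffAt ℝ (⊤ : ℕ∞) (fun t : ℝ => |u - t| ^ q) t :=
  (contDiffAt_abs_rpow q (sub_ne_zero.2 h)).comp t (contDiffAt_const.sub contDiffAt_id)

theorem iteratedDeriv_powerEntry (m : ℕ) {u t : ℝ} (h : u ≠ t) :
    iteratedDeriv m (powerEntry C p b u) t =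
      C b * ((iteratedDeriv m (fun t : ℝ => |u - t| ^ (-p b)) t : ℝ) : ℂ) := by
  have h1 : powerEntry C p b u = fun t => (|u - t| ^ (-p b) : ℝ) • C b := by
    funext t
    simp [powerEntry, mul_comm]
  rw [h1, iteratedDeriv_smul_const
    ((contDiffAt_abs_sub_rpow _ h).of_le (by exact_mod_cast le_top))]
  simp [mul_comm]

theorem continuousAt_iteratedDeriv_powerEntry (m : ℕ) {z : ℝ × ℝ} (h : z.1 ≠ z.2) :
    ContinuousAt (fun z : ℝ × ℝ => iteratedDeriv m (powerEntry C p b z.1) z.2) z := by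
  have hev : ∀ᶠ z' : ℝ × ℝ in nhds z, z'.1 ≠ z'.2 :=
    (isOpen_ne_fun continuous_fst continuous_snd).mem_nhds h
  -- Translation reduces joint continuity to that of a derivative of the one-variable function `|t|
  -- ^ (-p b)` away from `0`.
  have heq : (fun z : ℝ × ℝ => C b * (((-1 : ℝ) ^ m •
      iteratedDeriv m (fun t : ℝ => |t| ^ (-p b)) (z.1 - z.2) : ℝ) : ℂ)) =ᶠ[nhds z]
      (fun z : ℝ × ℝ => iteratedDeriv m (powerEntry C p b z.1) z.2) := by
    filter_upwards [hev] with z' hz'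
    rw [iteratedDeriv_powerEntry C p b m hz',
      iteratedDeriv_comp_const_sub (f := fun t : ℝ => |t| ^ (-p b)) (s := z'.1)]
  refine ContinuousAt.congr ?_ heq
  have hc : ContinuousAt (fun z : ℝ × ℝ =>
      iteratedDeriv m (fun t : ℝ => |t| ^ (-p b)) (z.1 - z.2)) z :=
    ContinuousAt.comp (f := fun z : ℝ × ℝ => z.1 - z.2)
      (continuousAt_iteratedDeriv m (contDiffAt_abs_rpow _ (sub_ne_zero.2 h)))
      (continuous_fst.sub continuous_snd).continuousAt
  exact continuousAt_const.mul
    (Complex.continuous_ofReal.continuousAt.comp (hc.const_smul ((-1 : ℝ) ^ m)))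

end PowerEntry

/-! ### The sum with perturbed evaluation points -/

theorem continuous_inverseFominSum {N : ℕ} (α : LinkPattern N) :
    Continuous fun 𝔎 : Fin (2 * N) → Fin (2 * N) → ℂ => inverseFominSum 𝔎 α := by
  unfold inverseFominSum
  refine continuous_finsetSum _ fun β _ => continuous_const.mul ?_
  unfold fominDet
  refine Continuous.matrix_det ?_
  refine continuous_matrix fun a b => ?_
  exact (continuous_apply (β.partner b.val)).comp (continuous_apply a.val)

theorem kernel_comm {n : ℕ} (F : Fin n → Fin n → ℝ → ℝ → ℂ) (x : Fin n → ℝ) (a b : Fin n) :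
    kernel F x a b = kernel F x b a := by
  rcases lt_trichotomy a b with h | rfl | h
  · simp [kernel, h, h.asymm]
  · rfl
  · simp [kernel, h, h.asymm]

section Fusion

variable {N d : ℕ} (ς : Valences d (2 * N)) (j : Fin d) (α : LinkPattern N)
  (F : Fin (2 * N) → Fin (2 * N) → ℝ → ℝ → ℂ) (C : Fin (2 * N) → ℂ) (p : Fin (2 * N) → ℝ)

/-- The normalized derivatives of the power entries at the points `θ m b`. -/
noncomputable def taylorRows (y : Fin (2 * N - ς.s j + 1) → ℝ)
    (θ : Fin (ς.s j) → Fin (2 * N) → ℝ) (m : Fin (ς.s j)) (b : Fin (2 * N)) : ℂ :=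
  (1 / (m.val.factorial : ℂ)) * iteratedDeriv m.val (powerEntry C p b (y (ς.fuse j b))) (θ m b)

/-- The inverse Fomin type sum of the fused kernel, with the derivatives evaluated at the points
`θ m b` instead of the fused point. -/
noncomputable def perturbedSum
    (z : (Fin (2 * N - ς.s j + 1) → ℝ) × (Fin (ς.s j) → Fin (2 * N) → ℝ)) : ℂ :=
  inverseFominSum (blockKernel ς j (kernel F fun k => z.1 (ς.fuse j k))
    (taylorRows ς j C p z.1 z.2)) α

/-- All evaluation points equal to the fused point. -/
def fusedPoints (y : Fin (2 * N - ς.s j + 1) → ℝ) : Fin (ς.s j) → Fin (2 * N) → ℝ :=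
  fun _ _ => y (ς.fuse j (ς.first j))

theorem perturbedSum_fusedPoints (y : Fin (2 * N - ς.s j + 1) → ℝ) :
    perturbedSum ς j α F C p (y, fusedPoints ς j y) =
      inverseFominSum (fusedKernel ς j F (powerEntry C p) y) α := by
  unfold perturbedSum
  congr 1

/-- After fusion, every point outside the block is still distinct from the fused point, so all
entries stay away from their singularities near `fusedPoints`. -/
theorem continuousAt_perturbedSum
    (hF : ∀ a b, a < b →
      ContDiffOn ℝ (⊤ : ℕ∞) (fun z : ℝ × ℝ => F a b z.1 z.2) {z | z.1 < z.2})
    {y : Fin (2 * N - ς.s j + 1) → ℝ} (hy : y ∈ chamber _) :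
    ContinuousAt (perturbedSum ς j α F C p) (y, fusedPoints ς j y) := by
  refine ContinuousAt.comp (f := fun z :
      (Fin (2 * N - ς.s j + 1) → ℝ) × (Fin (ς.s j) → Fin (2 * N) → ℝ) =>
      blockKernel ς j (kernel F fun k => z.1 (ς.fuse j k)) (taylorRows ς j C p z.1 z.2))
    (continuous_inverseFominSum α).continuousAt ?_
  have hrow : ∀ (m : Fin (ς.s j)) (b : Fin (2 * N)), b ∉ ς.block j →
      ContinuousAt (fun z : (Fin (2 * N - ς.s j + 1) → ℝ) × (Fin (ς.s j) → Fin (2 * N) → ℝ) =>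
        taylorRows ς j C p z.1 z.2 m b) (y, fusedPoints ς j y) := by
    intro m b hb
    refine continuousAt_const.mul ?_
    refine ContinuousAt.comp (g := fun z : ℝ × ℝ =>
        iteratedDeriv m.val (powerEntry C p b z.1) z.2)
      (f := fun z : (Fin (2 * N - ς.s j + 1) → ℝ) × (Fin (ς.s j) → Fin (2 * N) → ℝ) =>
        (z.1 (ς.fuse j b), z.2 m b)) (continuousAt_iteratedDeriv_powerEntry C p b m.val ?_)
      (by fun_prop)
    intro h
    have h1 := hy.injective h
    have hne : b ≠ ς.first j := fun h => hb (h ▸ ς.first_mem_block j)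
    rcases lt_or_gt_of_ne hne with h2 | h2
    · exact (ς.fuse_lt_fuse j h2 (Or.inl hb)).ne h1
    · exact (ς.fuse_lt_fuse j h2 (Or.inr hb)).ne' h1
  have hF' : ∀ a b, a < b → a ∉ ς.block j →
      ContinuousAt (fun z : (Fin (2 * N - ς.s j + 1) → ℝ) × (Fin (ς.s j) → Fin (2 * N) → ℝ) =>
        F a b (z.1 (ς.fuse j a)) (z.1 (ς.fuse j b))) (y, fusedPoints ς j y) := by
    intro a b hab ha
    refine ContinuousAt.comp (g := fun z : ℝ × ℝ => F a b z.1 z.2)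
      (f := fun z : (Fin (2 * N - ς.s j + 1) → ℝ) × (Fin (ς.s j) → Fin (2 * N) → ℝ) =>
        (z.1 (ς.fuse j a), z.1 (ς.fuse j b))) ?_ (by fun_prop)
    refine (hF a b hab).continuousOn.continuousAt
      ((isOpen_lt continuous_fst continuous_snd).mem_nhds ?_)
    exact hy (ς.fuse_lt_fuse j hab (Or.inl ha))
  refine continuousAt_pi.2 fun a => continuousAt_pi.2 fun b => ?_
  unfold blockKernel
  split_ifs with ha hb hb
  · exact continuousAt_const
  · exact hrow _ b hb
  · exact hrow _ a ha
  · unfold kernel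
    split_ifs with h1 h2
    · exact hF' a b h1 ha
    · exact hF' b a h2 hb
    · exact continuousAt_const

/-- Exact factorization of the sum: the remaining factor is the fused sum with evaluation points
between the first and the last point of the block. -/
theorem exists_inverseFominSum_eq (hα : ∀ a ∈ ς.block j, α.partner a ∉ ς.block j)
    {x : Fin (2 * N) → ℝ} (hx : x ∈ chamber (2 * N))
    (hK : ∀ a ∈ ς.block j, ∀ b, b ∉ ς.block j →
      kernel F x a b = powerEntry C p b (x b) (x a)) :
    ∃ θ : Fin (ς.s j) → Fin (2 * N) → ℝ,
      (∀ m b, ∃ m', θ m b ∈ Set.Icc (x (ς.first j)) (x (ς.point j m'))) ∧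
      inverseFominSum (kernel F x) α =
        (ς.fusionFactor j x : ℂ) * perturbedSum ς j α F C p (ς.reduce j x, θ) := by
  have hpos := ς.pos j
  set l : Fin (ς.s j) := ⟨ς.s j - 1, by omega⟩ with hl
  have hz : StrictMono fun m => x (ς.point j m) := fun m m' h => hx (by
    rw [Fin.lt_def] at *
    simp only [Valences.point]
    omega)
  have hfl : ∀ m, x (ς.point j m) ∈ Set.Icc (x (ς.first j)) (x (ς.point j l)) := fun m =>
    ⟨hz.monotone (a := ⟨0, hpos⟩) (Fin.le_def.2 (Nat.zero_le _)),
      hz.monotone (Fin.le_def.2 (by have := m.isLt; simp only [hl]; omega))⟩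
  have hout : ∀ b, b ∉ ς.block j → ∀ t ∈ Set.Icc (x (ς.first j)) (x (ς.point j l)),
      x b ≠ t := by
    rintro b hb t ⟨h1, h2⟩ rfl
    have h3 := Fin.le_def.1 (hx.le_iff_le.1 h1)
    have h4 := Fin.le_def.1 (hx.le_iff_le.1 h2)
    refine hb ((ς.mem_block j).2 ?_)
    simp only [Valences.first, Valences.point, hl] at h3 h4
    omega
  -- The points `θ` may depend on `b` but not on the row `i`, so one Newton matrix serves all
  -- columns. Indices `b` inside the block get a dummy value.
  have hb : ∀ b, ∃ θ : Fin (ς.s j) → ℝ,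
      (∀ m, θ m ∈ Set.Icc (x (ς.first j)) (x (ς.point j l))) ∧
      (b ∉ ς.block j → ∀ i, powerEntry C p b (x b) (x (ς.point j i)) =
        ∑ m, newtonMatrix (fun m => (x (ς.point j m) : ℂ)) i m *
          ((1 / (m.val.factorial : ℂ)) *
            iteratedDeriv m.val (powerEntry C p b (x b)) (θ m))) := by
    intro b
    by_cases hbm : b ∈ ς.block j
    · exact ⟨fun _ => x (ς.first j), fun m => hfl ⟨0, hpos⟩, fun h => absurd hbm h⟩
    · obtain ⟨θ, hθ, h⟩ := exists_newton_mean_value hz hfl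
        (fun t ht => contDiffAt_abs_sub_rpow (-p b) (hout b hbm t ht))
      refine ⟨θ, hθ, fun _ i => ?_⟩
      rw [powerEntry, h i, Complex.ofReal_sum, Finset.mul_sum]
      refine Finset.sum_congr rfl fun m _ => ?_
      rw [iteratedDeriv_powerEntry C p b m.val (hout b hbm _ (hθ m))]
      simp only [newtonMatrix, Matrix.of_apply]
      push_cast
      ring
  choose θ hθ h using hb
  refine ⟨fun m b => θ b m, fun m b => ⟨l, hθ b m⟩, ?_⟩
  let G : Fin (2 * N) → Fin (2 * N) → ℂ := kernel F fun k => ς.reduce j x (ς.fuse j k)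
  let w : Fin (ς.s j) → Fin (2 * N) → ℂ :=
    taylorRows ς j C p (ς.reduce j x) fun m b => θ b m
  have hred : ∀ b, b ∉ ς.block j → ς.reduce j x (ς.fuse j b) = x b := fun b hb => by
    rw [Valences.reduce, ς.keep_fuse j hb]
  have hdet : (newtonMatrix fun m => (x (ς.point j m) : ℂ)).det = (ς.fusionFactor j x : ℂ) := by
    rw [ς.fusionFactor_eq, det_newtonMatrix, det_newtonMatrix]
    push_cast
    rfl
  have hmap := alternatingMap_sum_matrix_smul (blockAlternating ς j G hα)
    (newtonMatrix fun m => (x (ς.point j m) : ℂ)) w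
  rw [hdet] at hmap
  refine Eq.trans ?_ hmap
  -- The entries inside the block, possibly singular at fusion, drop out before the limit.
  rw [inverseFominSum_erase_block ς j hα (kernel F x) (kernel_comm F x)
    (fun a => by simp [kernel])]
  change _ = inverseFominSum (blockKernel ς j G _) α
  congr 1
  have hrow : ∀ a (ha : a ∈ ς.block j) b, b ∉ ς.block j → kernel F x a b =
      (∑ k, newtonMatrix (fun m => (x (ς.point j m) : ℂ)) (ς.position j a ha) k • w k) b := by
    intro a ha b hb
    have h1 := h b hb (ς.position j a ha)
    rw [ς.point_position] at h1
    rw [hK a ha b hb, h1]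
    simp only [Finset.sum_apply, Pi.smul_apply, smul_eq_mul, w, taylorRows, hred b hb]
  funext a b
  by_cases ha : a ∈ ς.block j <;> by_cases hb : b ∈ ς.block j
  · simp [blockKernel, ha, hb]
  · simp only [blockKernel, ha, hb, and_false, if_false, dif_pos]
    exact hrow a ha b hb
  · simp only [blockKernel, ha, hb, false_and, if_false, dif_pos, dif_neg, not_false_iff]
    rw [kernel_comm]
    exact hrow b hb a ha
  · simp [blockKernel, ha, hb, G, kernel, hred]

theorem continuousOn_fusedSum
    (hF : ∀ a b, a < b →
      ContDiffOn ℝ (⊤ : ℕ∞) (fun z : ℝ × ℝ => F a b z.1 z.2) {z | z.1 < z.2}) :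
    ContinuousOn (fun y => inverseFominSum (fusedKernel ς j F (powerEntry C p) y) α)
      (chamber (2 * N - ς.s j + 1)) := by
  intro y hy
  simp only [← perturbedSum_fusedPoints]
  exact (ContinuousAt.comp (f := fun y => (y, fusedPoints ς j y))
    (continuousAt_perturbedSum ς j α F C p hF hy)
    (by unfold fusedPoints; fun_prop)).continuousWithinAt

/-- Uniformly on compact sets, the perturbed sum is close to the fused sum when the evaluation
points are close to the fused point. -/
theorem exists_forall_norm_perturbedSum_sub_lt
    (hF : ∀ a b, a < b →
      ContDiffOn ℝ (⊤ : ℕ∞) (fun z : ℝ × ℝ => F a b z.1 z.2) {z | z.1 < z.2})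
    {K : Set (Fin (2 * N - ς.s j + 1) → ℝ)} (hK : IsCompact K) (hKc : K ⊆ chamber _)
    {ε : ℝ} (hε : 0 < ε) :
    ∃ η : ℝ, 0 < η ∧ ∀ y ∈ K, ∀ θ : Fin (ς.s j) → Fin (2 * N) → ℝ,
      (∀ m b, |y (ς.fuse j (ς.first j)) - θ m b| < η) →
      ‖perturbedSum ς j α F C p (y, θ) -
        inverseFominSum (fusedKernel ς j F (powerEntry C p) y) α‖ < ε := by
  have hK' : IsCompact ((fun y => (y, fusedPoints ς j y)) '' K) :=
    hK.image (by unfold fusedPoints; fun_prop)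
  -- Only one of the two compared points has to lie in the compact set, so `θ` is unrestricted apart
  -- from its distance to the fused point.
  have hU := hK'.uniformContinuousAt_of_continuousAt (perturbedSum ς j α F C p)
    (by
      rintro _ ⟨y, hy, rfl⟩
      exact continuousAt_perturbedSum ς j α F C p hF (hKc hy))
    (Metric.dist_mem_uniformity hε)
  obtain ⟨η, hη, h⟩ := Metric.mem_uniformity_dist.1 hU
  refine ⟨η, hη, fun y hy θ hθ => ?_⟩
  have h1 : dist (y, fusedPoints ς j y) (y, θ) < η := by
    rw [Prod.dist_eq, dist_self]
    refine max_lt hη ((dist_pi_lt_iff hη).2 fun m => (dist_pi_lt_iff hη).2 fun b => ?_)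
    exact hθ m b
  have h2 := h h1 ⟨y, hy, rfl⟩
  rw [← perturbedSum_fusedPoints, ← dist_eq_norm, dist_comm]
  exact h2

end Fusion

end FominSum

/-! ### The asymptotics under fusion -/

theorem proposition6 {N d : ℕ} (ς : Valences d (2 * N)) (j : Fin d)
    (α : LinkPattern N) (hα : α.IsValenced ς)
    (F : Fin (2 * N) → Fin (2 * N) → ℝ → ℝ → ℂ)
    (hF : ∀ a b, a < b →
      ContDiffOn ℝ (⊤ : ℕ∞) (fun z : ℝ × ℝ => F a b z.1 z.2) {z | z.1 < z.2})
    (C : Fin (2 * N) → ℂ) (p : Fin (2 * N) → ℝ)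
    (hC : ∀ b, b ∉ ς.block j → C b ≠ 0) (hp : ∀ b, b ∉ ς.block j → 0 ≤ p b)
    (hK : ∀ x ∈ chamber (2 * N), ∀ a ∈ ς.block j, ∀ b, b ∉ ς.block j →
      kernel F x a b = powerEntry C p b (x b) (x a)) :
    (∀ K : Set (Fin (2 * N - ς.s j + 1) → ℝ), IsCompact K → K ⊆ chamber _ →
      ∃ r : (Fin (2 * N) → ℝ) → ℂ,
        (∀ x ∈ chamber (2 * N), ς.reduce j x ∈ K →
          inverseFominSum (kernel F x) α =
            (ς.fusionFactor j x : ℂ) *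
              (inverseFominSum (fusedKernel ς j F (powerEntry C p) (ς.reduce j x)) α + r x)) ∧
        ∀ ε : ℝ, 0 < ε → ∃ η : ℝ, 0 < η ∧ ∀ x ∈ chamber (2 * N), ς.reduce j x ∈ K →
          (∀ m, ς.gap j x m < η) → ‖r x‖ < ε) ∧
    (∀ K : Set (Fin (2 * N - ς.s j + 1) → ℝ), IsCompact K → K ⊆ chamber _ →
      (∀ y ∈ K, inverseFominSum (fusedKernel ς j F (powerEntry C p) y) α ≠ 0) →
      ∃ r : (Fin (2 * N) → ℝ) → ℂ,
        (∀ x ∈ chamber (2 * N), ς.reduce j x ∈ K →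
          inverseFominSum (kernel F x) α =
            (ς.fusionFactor j x : ℂ) *
              inverseFominSum (fusedKernel ς j F (powerEntry C p) (ς.reduce j x)) α *
                (1 + r x)) ∧
        ∀ ε : ℝ, 0 < ε → ∃ η : ℝ, 0 < η ∧ ∀ x ∈ chamber (2 * N), ς.reduce j x ∈ K →
          (∀ m, ς.gap j x m < η) → ‖r x‖ < ε) := by
  have hα' : ∀ a ∈ ς.block j, α.partner a ∉ ς.block j := hα j
  have main : ∀ K : Set (Fin (2 * N - ς.s j + 1) → ℝ), IsCompact K → K ⊆ chamber _ →
      ∃ r : (Fin (2 * N) → ℝ) → ℂ,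
        (∀ x ∈ chamber (2 * N), ς.reduce j x ∈ K →
          inverseFominSum (kernel F x) α =
            (ς.fusionFactor j x : ℂ) *
              (inverseFominSum (fusedKernel ς j F (powerEntry C p) (ς.reduce j x)) α + r x)) ∧
        ∀ ε : ℝ, 0 < ε → ∃ η : ℝ, 0 < η ∧ ∀ x ∈ chamber (2 * N), ς.reduce j x ∈ K →
          (∀ m, ς.gap j x m < η) → ‖r x‖ < ε := by
    intro K hKcomp hKsub
    have hD : ∀ x ∈ chamber (2 * N), (ς.fusionFactor j x : ℂ) ≠ 0 := fun x hx =>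
      Complex.ofReal_ne_zero.2 (ς.fusionFactor_ne_zero j hx)
    -- The error term is forced, since `D(x)` does not vanish on the chamber.
    refine ⟨fun x => inverseFominSum (kernel F x) α / (ς.fusionFactor j x : ℂ) -
      inverseFominSum (fusedKernel ς j F (powerEntry C p) (ς.reduce j x)) α, ?_, ?_⟩
    · intro x hx _
      rw [add_sub_cancel, mul_div_cancel₀ _ (hD x hx)]
    · intro ε hε
      obtain ⟨η, hη, h⟩ :=
        exists_forall_norm_perturbedSum_sub_lt ς j α F C p hF hKcomp hKsub hε
      refine ⟨η, hη, fun x hx hxK hgap => ?_⟩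
      obtain ⟨θ, hθ, hZ⟩ := exists_inverseFominSum_eq ς j α F C p hα' hx (hK x hx)
      simp only [hZ, mul_div_cancel_left₀ _ (hD x hx)]
      refine h _ hxK θ fun m b => ?_
      obtain ⟨m', h1, h2⟩ := hθ m b
      have h3 := hgap m'
      rw [Valences.gap] at h3
      rw [Valences.reduce, ς.keep_fuse_first, abs_lt]
      constructor <;> linarith
  refine ⟨main, fun K hKcomp hKsub hne => ?_⟩
  obtain ⟨r, hr, hsmall⟩ := main K hKcomp hKsub
  -- A positive lower bound on the compact set turns the additive error into a relative one: `ε * c`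
  -- in (1) yields `ε` in (2).
  obtain ⟨c, hc, hcK⟩ : ∃ c : ℝ, 0 < c ∧ ∀ y ∈ K,
      c ≤ ‖inverseFominSum (fusedKernel ς j F (powerEntry C p) y) α‖ :=
    hKcomp.exists_forall_le' ((continuousOn_fusedSum ς j α F C p hF).mono hKsub).norm
      fun y hy => norm_pos_iff.2 (hne y hy)
  refine ⟨fun x => r x / inverseFominSum (fusedKernel ς j F (powerEntry C p) (ς.reduce j x)) α,
    fun x hx hxK => ?_, fun ε hε => ?_⟩
  · rw [hr x hx hxK, mul_assoc, mul_one_add, mul_div_cancel₀ _ (hne _ hxK)]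
  · obtain ⟨η, hη, h⟩ := hsmall (ε * c) (mul_pos hε hc)
    refine ⟨η, hη, fun x hx hxK hgap => ?_⟩
    rw [norm_div, div_lt_iff₀ (norm_pos_iff.2 (hne _ hxK))]
    exact (h x hx hxK hgap).trans_le (mul_le_mul_of_nonneg_left (hcK _ hxK) hε.le)
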